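/- **Two-scale limits in $H(\mathrm{curl})$.** Let $D\subset\mathbb{R}^3$ be open (for instance a domain with Lipschitz boundary), let $Y=(0,1)^3$, and let $\varepsilon$ run through a sequence of positive numbers tending to $0$. All functions are real-valued. *Spaces.* $H(\mathrm{curl},D)$ is the space of $w\in L^2(D)^3$ whose weak curl lies in $L^2(D)^3$, with norm $(\|w\|^2+\|\mathrm{curl}\,w\|^2)^{1/2}$. $H^1_\#(Y)$ (resp. $H_\#(\mathrm{curl},Y)$) is the space of elements of $H^1(Y)$ (resp. $H(\mathrm{curl},Y)$) that extend $Y$-periodically to an element of $H^1_{\rm loc}(\mathbb{R}^3)$ (resp. $H_{\rm loc}(\mathrm{curl},\mathbb{R}^3)$). $H^1_\#(Y)/\mathbb{R}$ is the quotient by the constant functions, and $\tilde H_\#(\mathrm{curl},Y)$ is the space of classes of functions in $H_\#(\mathrm{curl},Y)$, where $\phi,\psi$ are identified if $\mathrm{curl}_y\phi=\mathrm{curl}_y\psi$, with norm $\|\phi\|=\|\mathrm{curl}_y\phi\|_{L^2(Y)^3}$. *Two-scale convergence.* A sequence $w^\varepsilon\in L^2(D)$ two-scale converges to $\xi\in L^2(D\times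 Y)$ if $$\lim_{\varepsilon\to0}\int_D w^\varepsilon(x)\,\phi\!\left(x,\tfrac{x}{\varepsilon}\right)dx=\int_D\int_Y \xi(x,y)\,\phi(x,y)\,dy\,dx$$ for every $\phi\in C^\infty(D\times\mathbb{R}^3)$ which is $Y$-periodic in $y$ and for which $\sup_y|\phi(\cdot,y)|$ is dominated by a function in $L^2(D)$. For vector fields the convergence is understood componentwise. *Statement.* Let $\{w^\varepsilon\}_\varepsilon$ be a bounded sequence in $H(\mathrm{curl},D)$. Then there are a subsequence (not renumbered) and functions $w_0\in H(\mathrm{curl},D)$, $\mathfrak w_1\in L^2(D,H^1_\#(Y)/\mathbb{R})$ and $w_1\in L^2(D,\tilde H_\#(\mathrm{curl},Y))$ such that, along this one subsequence, in the sense of two-scale convergence, $$w^\varepsilon\longrightarrow w_0+\nabla_y\mathfrak w_1\qquad\text{and}\qquad \mathrm{curl}\,w^\varepsilon\longrightarrow \mathrm{curl}\,w_0+\mathrm{curl}_y w_1 .$$ -/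

import Mathlib

open MeasureTheory Filter Topology Set
open scoped ContDiff

noncomputable section

namespace TwoScaleCurl

/-- Euclidean space `ℝ³`. -/
abbrev E3 : Type := EuclideanSpace ℝ (Fin 3)

/-- The `i`-th standard basis vector of `ℝ³`. -/
def e (i : Fin 3) : E3 := EuclideanSpace.single i 1

/-- The partial derivative `∂ᵢ f` of a real function on `ℝ³`. -/
def pd (i : Fin 3) (f : E3 → ℝ) (x : E3) : ℝ := fderiv ℝ f x (e i)

/-- The classical curl of a (smooth) vector field on `ℝ³`. -/
def curl (φ : E3 → E3) (x : E3) : E3 :=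
  !₂[pd 1 (fun z => φ z 2) x - pd 2 (fun z => φ z 1) x,
     pd 2 (fun z => φ z 0) x - pd 0 (fun z => φ z 2) x,
     pd 0 (fun z => φ z 1) x - pd 1 (fun z => φ z 0) x]

/-- `L²(Ω; F)` with respect to Lebesgue measure. -/
abbrev L2 (Ω : Set E3) (F : Type) [NormedAddCommGroup F] : Type :=
  Lp F 2 (volume.restrict Ω)

/-- `u` belongs to `L²_loc(Ω; F)`. -/
def MemL2loc {F : Type} [NormedAddCommGroup F] (u : E3 → F) (Ω : Set E3) : Prop :=
  ∀ K : Set E3, IsCompact K → K ⊆ Ω → MemLp u 2 (volume.restrict K)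

/-- `φ` is a test function in `C₀^∞(Ω; F)`. -/
def IsTest {F : Type} [NormedAddCommGroup F] [NormedSpace ℝ F] (Ω : Set E3) (φ : E3 → F) : Prop :=
  ContDiff ℝ ∞ φ ∧ HasCompactSupport φ ∧ tsupport φ ⊆ Ω

/-- `c` is the weak (distributional) curl of `u` in `Ω`. -/
def HasWeakCurl (Ω : Set E3) (u c : E3 → E3) : Prop :=
  ∀ φ : E3 → E3, IsTest Ω φ →
    ∫ x in Ω, inner ℝ (u x) (curl φ x) = ∫ x in Ω, inner ℝ (c x) (φ x)

/-- `g` is the weak (distributional) gradient of `u` in `Ω`. -/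
def HasWeakGrad (Ω : Set E3) (u : E3 → ℝ) (g : E3 → E3) : Prop :=
  ∀ φ : E3 → ℝ, IsTest Ω φ → ∀ i : Fin 3,
    ∫ x in Ω, u x * pd i φ x = - ∫ x in Ω, g x i * φ x

/-! ### Linearity of the weak derivatives -/

lemma MemL2loc.add {F : Type} [NormedAddCommGroup F] {Ω : Set E3} {u v : E3 → F}
    (hu : MemL2loc u Ω) (hv : MemL2loc v Ω) : MemL2loc (fun x => u x + v x) Ω :=
  fun K hK hKΩ => (hu K hK hKΩ).add (hv K hK hKΩ)

lemma MemL2loc.smul {F : Type} [NormedAddCommGroup F] [NormedSpace ℝ F] {Ω : Set E3} {u : E3 → F}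
    (a : ℝ) (hu : MemL2loc u Ω) : MemL2loc (fun x => a • u x) Ω :=
  fun K hK hKΩ => (hu K hK hKΩ).const_smul a

lemma memL2loc_zero {F : Type} [NormedAddCommGroup F] {Ω : Set E3} :
    MemL2loc (fun _ => (0 : F)) Ω :=
  fun _ _ _ => MemLp.zero'

lemma memL2loc_Lp {F : Type} [NormedAddCommGroup F] {Ω : Set E3} (u : L2 Ω F) :
    MemL2loc u Ω :=
  fun _ _ hKΩ => (Lp.memLp u).mono_measure (Measure.restrict_mono hKΩ le_rfl)

lemma MemL2loc.comp_coord {Ω : Set E3} {g : E3 → E3} (hg : MemL2loc g Ω) (i : Fin 3) :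
    MemL2loc (fun x => g x i) Ω := by
  intro K hK hKΩ
  refine (hg K hK hKΩ).of_le ?_ (ae_of_all _ fun x => PiLp.norm_apply_le (g x) i)
  exact (EuclideanSpace.proj (𝕜 := ℝ) i).continuous.comp_aestronglyMeasurable
    (hg K hK hKΩ).aestronglyMeasurable

lemma MemL2loc.integrable_inner {F : Type} [NormedAddCommGroup F] [InnerProductSpace ℝ F]
    {Ω : Set E3} {u ψ : E3 → F} (hu : MemL2loc u Ω) (hψ : Continuous ψ) (hc : HasCompactSupport ψ)
    (hs : tsupport ψ ⊆ Ω) : Integrable (fun x => inner ℝ (u x) (ψ x)) (volume.restrict Ω) := by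
  have h1 : MemLp u 2 (volume.restrict (tsupport ψ)) := hu _ hc hs
  have h2 : MemLp ψ 2 (volume.restrict (tsupport ψ)) :=
    (hψ.memLp_of_hasCompactSupport hc).restrict _
  have h3 : IntegrableOn (fun x => inner ℝ (u x) (ψ x)) (tsupport ψ) volume := by
    refine ((h1.norm.integrable_mul h2.norm)).mono'
      (h1.aestronglyMeasurable.inner h2.aestronglyMeasurable)
      (ae_of_all _ fun x => norm_inner_le_norm (u x) (ψ x))
  refine Integrable.restrict ((integrableOn_iff_integrable_of_support_subset ?_).1 h3)
  intro x hx
  by_contra hx'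
  exact hx (by simp [image_eq_zero_of_notMem_tsupport hx'])

lemma tsupport_pd_subset (i : Fin 3) (f : E3 → ℝ) : tsupport (pd i f) ⊆ tsupport f :=
  tsupport_fderiv_apply_subset ℝ (e i)

lemma continuous_pd {f : E3 → ℝ} (hf : ContDiff ℝ ∞ f) (i : Fin 3) : Continuous (pd i f) :=
  (hf.continuous_fderiv (by simp)).clm_apply continuous_const

lemma IsTest.coord {Ω : Set E3} {φ : E3 → E3} (h : IsTest Ω φ) (i : Fin 3) :
    IsTest Ω (fun x => φ x i) := by
  have hs : tsupport (fun x => φ x i) ⊆ tsupport φ := by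
    refine closure_mono fun x hx hx' => hx ?_
    simp [hx']
  refine ⟨?_, h.2.1.of_isClosed_subset (isClosed_tsupport _) hs, hs.trans h.2.2⟩
  exact (EuclideanSpace.proj (𝕜 := ℝ) i).contDiff.comp h.1

lemma tsupport_curl_subset (φ : E3 → E3) : tsupport (curl φ) ⊆ tsupport φ := by
  have key : ∀ x, x ∉ tsupport φ → ∀ i j, pd i (fun z => φ z j) x = 0 := by
    intro x hx i j
    refine image_eq_zero_of_notMem_tsupport fun h => hx ?_
    refine closure_mono ?_ (tsupport_pd_subset i _ h)
    intro z hz hz'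
    exact hz (by simp [hz'])
  refine closure_minimal (fun x hx => ?_) (isClosed_tsupport φ)
  by_contra h
  apply hx
  ext j
  fin_cases j <;> simp [curl, key x h]

lemma continuous_curl {φ : E3 → E3} (hφ : ContDiff ℝ ∞ φ) : Continuous (curl φ) := by
  have h : ∀ j : Fin 3, ContDiff ℝ ∞ (fun z => φ z j) := fun j =>
    (EuclideanSpace.proj (𝕜 := ℝ) j).contDiff.comp hφ
  have h' := fun i j => continuous_pd (h j) i
  refine (PiLp.continuous_toLp 2 (fun _ : Fin 3 => ℝ)).comp ?_
  refine continuous_pi fun j => ?_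
  fin_cases j
  · exact (h' 1 2).sub (h' 2 1)
  · exact (h' 2 0).sub (h' 0 2)
  · exact (h' 0 1).sub (h' 1 0)

lemma IsTest.integrable_curl {Ω : Set E3} {φ : E3 → E3} (h : IsTest Ω φ) {u : E3 → E3}
    (hu : MemL2loc u Ω) :
    Integrable (fun x => inner ℝ (u x) (curl φ x)) (volume.restrict Ω) :=
  hu.integrable_inner (continuous_curl h.1)
    (h.2.1.of_isClosed_subset (isClosed_tsupport _) (tsupport_curl_subset φ))
    ((tsupport_curl_subset φ).trans h.2.2)

lemma IsTest.integrable_inner {Ω : Set E3} {φ : E3 → E3} (h : IsTest Ω φ) {u : E3 → E3}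
    (hu : MemL2loc u Ω) :
    Integrable (fun x => inner ℝ (u x) (φ x)) (volume.restrict Ω) :=
  hu.integrable_inner h.1.continuous h.2.1 h.2.2

lemma IsTest.integrable_mul {Ω : Set E3} {φ : E3 → ℝ} (h : IsTest Ω φ) {u : E3 → ℝ}
    (hu : MemL2loc u Ω) : Integrable (fun x => u x * φ x) (volume.restrict Ω) := by
  simpa [mul_comm] using hu.integrable_inner h.1.continuous h.2.1 h.2.2

lemma IsTest.integrable_mul_pd {Ω : Set E3} {φ : E3 → ℝ} (h : IsTest Ω φ) {u : E3 → ℝ}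
    (hu : MemL2loc u Ω) (i : Fin 3) :
    Integrable (fun x => u x * pd i φ x) (volume.restrict Ω) := by
  simpa [mul_comm] using hu.integrable_inner (continuous_pd h.1 i)
    (h.2.1.of_isClosed_subset (isClosed_tsupport _) (tsupport_pd_subset i φ))
    ((tsupport_pd_subset i φ).trans h.2.2)

lemma HasWeakCurl.zero (Ω : Set E3) : HasWeakCurl Ω (fun _ => 0) (fun _ => 0) := by
  intro φ _; simp

lemma HasWeakCurl.add {Ω : Set E3} {u v c d : E3 → E3} (hu : MemL2loc u Ω) (hv : MemL2loc v Ω)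
    (hc : MemL2loc c Ω) (hd : MemL2loc d Ω) (h : HasWeakCurl Ω u c) (h' : HasWeakCurl Ω v d) :
    HasWeakCurl Ω (fun x => u x + v x) (fun x => c x + d x) := by
  intro φ hφ
  simp only [inner_add_left]
  rw [integral_add (hφ.integrable_curl hu) (hφ.integrable_curl hv),
    integral_add (hφ.integrable_inner hc) (hφ.integrable_inner hd), h φ hφ, h' φ hφ]

lemma HasWeakCurl.smul {Ω : Set E3} {u c : E3 → E3} (a : ℝ) (h : HasWeakCurl Ω u c) :
    HasWeakCurl Ω (fun x => a • u x) (fun x => a • c x) := by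
  intro φ hφ
  simp only [real_inner_smul_left, integral_const_mul, h φ hφ]

lemma HasWeakCurl.congr {Ω : Set E3} {u v c d : E3 → E3} (h : HasWeakCurl Ω u c)
    (hu : v =ᵐ[volume.restrict Ω] u) (hc : d =ᵐ[volume.restrict Ω] c) : HasWeakCurl Ω v d := by
  intro φ hφ
  refine (integral_congr_ae (hu.mono fun x hx => ?_)).trans
    ((h φ hφ).trans (integral_congr_ae (hc.mono fun x hx => ?_)).symm)
  · simp only [hx]
  · simp only [hx]

lemma HasWeakGrad.zero (Ω : Set E3) : HasWeakGrad Ω (fun _ => 0) (fun _ => 0) := by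
  intro φ _ i; simp

lemma HasWeakGrad.add {Ω : Set E3} {u v : E3 → ℝ} {g k : E3 → E3} (hu : MemL2loc u Ω)
    (hv : MemL2loc v Ω) (hg : MemL2loc g Ω) (hk : MemL2loc k Ω) (h : HasWeakGrad Ω u g)
    (h' : HasWeakGrad Ω v k) : HasWeakGrad Ω (fun x => u x + v x) (fun x => g x + k x) := by
  intro φ hφ i
  simp only [add_mul, PiLp.add_apply]
  rw [integral_add (hφ.integrable_mul_pd hu i) (hφ.integrable_mul_pd hv i),
    integral_add (hφ.integrable_mul (hg.comp_coord i)) (hφ.integrable_mul (hk.comp_coord i)),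
    h φ hφ i, h' φ hφ i]
  ring

lemma HasWeakGrad.smul {Ω : Set E3} {u : E3 → ℝ} {g : E3 → E3} (a : ℝ) (h : HasWeakGrad Ω u g) :
    HasWeakGrad Ω (fun x => a • u x) (fun x => a • g x) := by
  intro φ hφ i
  simp only [smul_eq_mul, PiLp.smul_apply, mul_assoc, integral_const_mul, h φ hφ i, mul_neg]

lemma HasWeakGrad.congr {Ω : Set E3} {u v : E3 → ℝ} {g k : E3 → E3} (h : HasWeakGrad Ω u g)
    (hu : v =ᵐ[volume.restrict Ω] u) (hg : k =ᵐ[volume.restrict Ω] g) : HasWeakGrad Ω v k := by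
  intro φ hφ i
  refine (integral_congr_ae (hu.mono fun x hx => ?_)).trans
    ((h φ hφ i).trans (congrArg Neg.neg (integral_congr_ae (hg.mono fun x hx => ?_)).symm))
  · simp only [hx]
  · simp only [hx]

/-! ### The spaces `H(curl, Ω)` and `H¹(Ω)` -/

/-- `H(curl, Ω)`: a vector field `u ∈ L²(Ω)³` together with its weak curl `c ∈ L²(Ω)³`,
with the norm `(‖u‖² + ‖curl u‖²)^{1/2}`. -/
def HCurl (Ω : Set E3) : Submodule ℝ (WithLp 2 (L2 Ω E3 × L2 Ω E3)) where
  carrier := {p | HasWeakCurl Ω p.fst p.snd}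
  zero_mem' := (HasWeakCurl.zero Ω).congr (Lp.coeFn_zero _ _ _) (Lp.coeFn_zero _ _ _)
  add_mem' hp hq :=
    (HasWeakCurl.add (memL2loc_Lp _) (memL2loc_Lp _) (memL2loc_Lp _) (memL2loc_Lp _) hp hq).congr
      (Lp.coeFn_add _ _) (Lp.coeFn_add _ _)
  smul_mem' a _ hp := (HasWeakCurl.smul a hp).congr (Lp.coeFn_smul _ _) (Lp.coeFn_smul _ _)

/-- The underlying `L²` vector field of an element of `H(curl, Ω)`. -/
def HCurl.toL2 {Ω : Set E3} : HCurl Ω →L[ℝ] L2 Ω E3 :=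
  (WithLp.fstL 2 ℝ (L2 Ω E3) (L2 Ω E3)).comp (HCurl Ω).subtypeL

/-- The weak curl of an element of `H(curl, Ω)`. -/
def HCurl.curl {Ω : Set E3} : HCurl Ω →L[ℝ] L2 Ω E3 :=
  (WithLp.sndL 2 ℝ (L2 Ω E3) (L2 Ω E3)).comp (HCurl Ω).subtypeL

/-- `H¹(Ω)`: a function `u ∈ L²(Ω)` together with its weak gradient `g ∈ L²(Ω)³`,
with the norm `(‖u‖² + ‖∇u‖²)^{1/2}`. -/
def H1 (Ω : Set E3) : Submodule ℝ (WithLp 2 (L2 Ω ℝ × L2 Ω E3)) where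
  carrier := {p | HasWeakGrad Ω p.fst p.snd}
  zero_mem' := (HasWeakGrad.zero Ω).congr (Lp.coeFn_zero _ _ _) (Lp.coeFn_zero _ _ _)
  add_mem' hp hq :=
    (HasWeakGrad.add (memL2loc_Lp _) (memL2loc_Lp _) (memL2loc_Lp _) (memL2loc_Lp _) hp hq).congr
      (Lp.coeFn_add _ _) (Lp.coeFn_add _ _)
  smul_mem' a _ hp := (HasWeakGrad.smul a hp).congr (Lp.coeFn_smul _ _) (Lp.coeFn_smul _ _)

/-- The underlying `L²` function of an element of `H¹(Ω)`. -/
def H1.toL2 {Ω : Set E3} : H1 Ω →L[ℝ] L2 Ω ℝ :=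
  (WithLp.fstL 2 ℝ (L2 Ω ℝ) (L2 Ω E3)).comp (H1 Ω).subtypeL

/-- The weak gradient of an element of `H¹(Ω)`. -/
def H1.grad {Ω : Set E3} : H1 Ω →L[ℝ] L2 Ω E3 :=
  (WithLp.sndL 2 ℝ (L2 Ω ℝ) (L2 Ω E3)).comp (H1 Ω).subtypeL

/-! ### Periodic spaces on the unit cell -/

/-- The open unit cube in `ℝ³`. -/
def Y : Set E3 := {y | ∀ i, y i ∈ Ioo (0 : ℝ) 1}

/-- Periodicity with period cell `Y`. -/
def YPeriodic {F : Type} (u : E3 → F) : Prop := ∀ (i : Fin 3) (y : E3), u (y + e i) = u y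

lemma isOpen_Y : IsOpen Y := by
  have : Y = ⋂ i : Fin 3, (fun y : E3 => y i) ⁻¹' Ioo (0 : ℝ) 1 := by ext; simp [Y]
  rw [this]
  exact isOpen_iInter_of_finite fun i => isOpen_Ioo.preimage (EuclideanSpace.proj (𝕜 := ℝ) i).continuous

lemma volume_Y : volume Y = 1 := by
  have : Y = (MeasurableEquiv.toLp 2 (Fin 3 → ℝ)).symm ⁻¹' (Set.pi univ fun _ => Ioo (0 : ℝ) 1) := by
    ext; simp [Y]
  rw [this, (EuclideanSpace.volume_preserving_symm_measurableEquiv_toLp (Fin 3)).measure_preimage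
    (MeasurableSet.univ_pi fun _ => measurableSet_Ioo).nullMeasurableSet, volume_pi_pi]
  simp

instance : IsFiniteMeasure (volume.restrict Y) := ⟨by simp [volume_Y]⟩

/-- `H_#(curl, Y)`: the elements of `H(curl, Y)` which extend periodically to an element of
`H_loc(curl, ℝ³)`. -/
def HCurlPer : Submodule ℝ (HCurl Y) where
  carrier := {v | ∃ U C : E3 → E3, YPeriodic U ∧ MemL2loc U univ ∧ MemL2loc C univ ∧
    HasWeakCurl univ U C ∧ U =ᵐ[volume.restrict Y] HCurl.toL2 v}
  zero_mem' := ⟨fun _ => 0, fun _ => 0, fun _ _ => rfl, memL2loc_zero, memL2loc_zero,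
    HasWeakCurl.zero _, by rw [map_zero]; exact (Lp.coeFn_zero _ _ _).symm⟩
  add_mem' := by
    rintro v v' ⟨U, C, hp, hU, hC, hw, hv⟩ ⟨U', C', hp', hU', hC', hw', hv'⟩
    refine ⟨_, _, fun i y => ?_, hU.add hU', hC.add hC', hw.add hU hU' hC hC' hw', ?_⟩
    · simp only [hp i y, hp' i y]
    · rw [map_add]
      exact (hv.add hv').trans (Lp.coeFn_add _ _).symm
  smul_mem' := by
    rintro a v ⟨U, C, hp, hU, hC, hw, hv⟩
    refine ⟨_, _, fun i y => ?_, hU.smul a, hC.smul a, hw.smul a, ?_⟩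
    · simp only [hp i y]
    · rw [map_smul]
      exact (hv.const_smul a).trans (Lp.coeFn_smul _ _).symm

/-- `H¹_#(Y)`: the elements of `H¹(Y)` which extend periodically to an element of
`H¹_loc(ℝ³)`. -/
def H1Per : Submodule ℝ (H1 Y) where
  carrier := {v | ∃ (U : E3 → ℝ) (G : E3 → E3), YPeriodic U ∧ MemL2loc U univ ∧
    MemL2loc G univ ∧ HasWeakGrad univ U G ∧ U =ᵐ[volume.restrict Y] H1.toL2 v}
  zero_mem' := ⟨fun _ => 0, fun _ => 0, fun _ _ => rfl, memL2loc_zero, memL2loc_zero,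
    HasWeakGrad.zero _, by rw [map_zero]; exact (Lp.coeFn_zero _ _ _).symm⟩
  add_mem' := by
    rintro v v' ⟨U, C, hp, hU, hC, hw, hv⟩ ⟨U', C', hp', hU', hC', hw', hv'⟩
    refine ⟨_, _, fun i y => ?_, hU.add hU', hC.add hC', hw.add hU hU' hC hC' hw', ?_⟩
    · simp only [hp i y, hp' i y]
    · rw [map_add]
      exact (hv.add hv').trans (Lp.coeFn_add _ _).symm
  smul_mem' := by
    rintro a v ⟨U, C, hp, hU, hC, hw, hv⟩
    refine ⟨_, _, fun i y => ?_, hU.smul a, hC.smul a, hw.smul a, ?_⟩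
    · simp only [hp i y]
    · rw [map_smul]
      exact (hv.const_smul a).trans (Lp.coeFn_smul _ _).symm

/-- The curl operator `H_#(curl, Y) → L²(Y)³`. -/
def curlPer : HCurlPer →ₗ[ℝ] L2 Y E3 :=
  (HCurl.curl : HCurl Y →L[ℝ] L2 Y E3).toLinearMap ∘ₗ HCurlPer.subtype

/-- `H̃_#(curl, Y)`: classes of functions in `H_#(curl, Y)`, where two functions are identified
if they have the same curl. -/
def HCurlTilde : Type := HCurlPer ⧸ LinearMap.ker curlPer

instance : AddCommGroup HCurlTilde :=
  inferInstanceAs (AddCommGroup (HCurlPer ⧸ LinearMap.ker curlPer))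

instance : Module ℝ HCurlTilde :=
  inferInstanceAs (Module ℝ (HCurlPer ⧸ LinearMap.ker curlPer))

/-- The class in `H̃_#(curl, Y)` of a function in `H_#(curl, Y)`. -/
def HCurlTilde.mk : HCurlPer →ₗ[ℝ] HCurlTilde := (LinearMap.ker curlPer).mkQ

/-- The operator `curl_y` on `H̃_#(curl, Y)`. -/
def curlY : HCurlTilde →ₗ[ℝ] L2 Y E3 := (LinearMap.ker curlPer).liftQ curlPer le_rfl

lemma curlY_mk (v : HCurlPer) : curlY (HCurlTilde.mk v) = HCurl.curl (v : HCurl Y) := rfl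

lemma curlY_injective : Function.Injective curlY :=
  LinearMap.ker_eq_bot.1 (Submodule.ker_liftQ_eq_bot _ _ _ le_rfl)

/-- The norm `‖φ‖ = ‖curl_y φ‖_{L²(Y)³}` on `H̃_#(curl, Y)`. -/
instance : NormedAddCommGroup HCurlTilde :=
  NormedAddCommGroup.induced HCurlTilde (L2 Y E3) curlY curlY_injective

instance : NormedSpace ℝ HCurlTilde := NormedSpace.induced ℝ HCurlTilde (L2 Y E3) curlY

lemma HCurlTilde.norm_eq (v : HCurlTilde) : ‖v‖ = ‖curlY v‖ := rfl

/-- The constant functions in `H¹_#(Y)`. -/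
def constants : Submodule ℝ H1Per :=
  (LinearMap.range (Lp.constₗ 2 (volume.restrict Y) ℝ : ℝ →ₗ[ℝ] L2 Y ℝ)).comap
    ((H1.toL2 : H1 Y →L[ℝ] L2 Y ℝ).comp H1Per.subtypeL).toLinearMap

instance : IsClosed (constants : Set H1Per) :=
  (Submodule.closed_of_finiteDimensional
    (LinearMap.range (Lp.constₗ 2 (volume.restrict Y) ℝ : ℝ →ₗ[ℝ] L2 Y ℝ))).preimage
    ((H1.toL2 : H1 Y →L[ℝ] L2 Y ℝ).comp H1Per.subtypeL).continuous

/-- `H¹_#(Y)/ℝ`, the quotient by the constant functions, with the quotient norm. -/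
abbrev H1PerModConst : Type := H1Per ⧸ constants

/-- The gradient operator `H¹_#(Y) → L²(Y)³`. -/
def gradPer : H1Per →ₗ[ℝ] L2 Y E3 :=
  (H1.grad : H1 Y →L[ℝ] L2 Y E3).toLinearMap ∘ₗ H1Per.subtype

lemma integral_pd_eq_zero {φ : E3 → ℝ} {Ω : Set E3} (h : IsTest Ω φ) (i : Fin 3) :
    ∫ x in Ω, pd i φ x = 0 := by
  have hs : ∀ x, x ∉ Ω → pd i φ x = 0 := fun x hx =>
    image_eq_zero_of_notMem_tsupport fun h' => hx (h.2.2 (tsupport_pd_subset i φ h'))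
  rw [setIntegral_eq_integral_of_forall_compl_eq_zero hs]
  have hi : Integrable (pd i φ) volume :=
    (continuous_pd h.1 i).integrable_of_hasCompactSupport
      (h.2.1.of_isClosed_subset (isClosed_tsupport _) (tsupport_pd_subset i φ))
  have hi' : Integrable φ volume := h.1.continuous.integrable_of_hasCompactSupport h.2.1
  have := integral_mul_fderiv_eq_neg_fderiv_mul_of_integrable (μ := (volume : Measure E3))
    (f := fun _ : E3 => (1 : ℝ)) (g := φ) (v := e i)
    (by simp) (by simpa [pd] using (show Integrable (fun x => fderiv ℝ φ x (e i)) volume from hi)) (by simpa using hi') (fun x _ => by fun_prop)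
    (fun x _ => (h.1.differentiable (by simp)).differentiableAt)
  simpa [pd] using this

lemma constants_le_ker : constants ≤ LinearMap.ker gradPer := by
  rintro v ⟨a, ha⟩
  have ha' : H1.toL2 (v : H1 Y) =ᵐ[volume.restrict Y] fun _ => a := by
    have h1 : Lp.const 2 (volume.restrict Y) a = H1.toL2 (v : H1 Y) := ha
    rw [← h1]
    exact Lp.coeFn_const _ _ _
  have hw : HasWeakGrad Y (H1.toL2 (v : H1 Y)) (H1.grad (v : H1 Y)) := (v : H1 Y).2
  have hz : ∀ i : Fin 3, ∀ᵐ x ∂(volume : Measure E3), x ∈ Y → H1.grad (v : H1 Y) x i = 0 := by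
    intro i
    have hm := (memL2loc_Lp (H1.grad (v : H1 Y))).comp_coord i
    refine isOpen_Y.ae_eq_zero_of_integral_contDiff_smul_eq_zero ?_ ?_
    · refine (locallyIntegrableOn_iff isOpen_Y.isLocallyClosed).2 fun K hKY hK => ?_
      have : IsFiniteMeasure (volume.restrict K) := ⟨by simpa using hK.measure_lt_top⟩
      exact (hm K hK hKY).integrable (by norm_num)
    · intro φ hφ hc hs
      have hT : IsTest Y φ := ⟨hφ, hc, hs⟩
      have h1 := hw φ hT i
      rw [integral_congr_ae (g := fun x => a * pd i φ x) (ha'.mono fun x hx => by simp [hx]),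
        integral_const_mul, integral_pd_eq_zero hT i, mul_zero] at h1
      have h2 : ∫ x in Y, φ x • H1.grad (v : H1 Y) x i = 0 := by
        simp only [smul_eq_mul, mul_comm (φ _)]
        linarith
      rw [← h2, eq_comm]
      refine setIntegral_eq_integral_of_forall_compl_eq_zero fun x hx => ?_
      rw [image_eq_zero_of_notMem_tsupport fun h => hx (hs h), zero_smul]
  change H1.grad (v : H1 Y) = 0
  refine Lp.ext ?_
  refine EventuallyEq.trans ?_ (Lp.coeFn_zero _ _ _).symm
  refine (ae_restrict_iff' isOpen_Y.measurableSet).2 ?_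
  filter_upwards [hz 0, hz 1, hz 2] with x h0 h1 h2 hx
  ext i
  fin_cases i
  · exact h0 hx
  · exact h1 hx
  · exact h2 hx

/-- The operator `∇_y` on `H¹_#(Y)/ℝ`. -/
def gradY : H1PerModConst →ₗ[ℝ] L2 Y E3 := constants.liftQ gradPer constants_le_ker

lemma gradY_mk (v : H1Per) : gradY (constants.mkQ v) = H1.grad (v : H1 Y) := rfl

/-! ### Two-scale convergence -/

/-- The product measure on `D × Y`. -/
abbrev volDY (D : Set E3) : Measure (E3 × E3) := (volume.restrict D).prod (volume.restrict Y)

/-- Test functions for two-scale convergence: `φ(x, y)` is smooth on `D × ℝ³` and `Y`-periodic in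
`y`, and `sup_y |φ(x, y)|` is dominated by a function in `L²(D)`, so that both sides of the
defining limit are integrals of integrable functions. If `D` is bounded, every bounded smooth
periodic function (in particular every one which is smooth up to the boundary of `D`) qualifies. -/
structure IsTwoScaleTest (D : Set E3) (φ : E3 → E3 → ℝ) : Prop where
  smooth : ContDiffOn ℝ ∞ (fun p : E3 × E3 => φ p.1 p.2) (D ×ˢ univ)
  periodic : ∀ x ∈ D, YPeriodic (φ x)
  dominated : ∃ g : E3 → ℝ, MemLp g 2 (volume.restrict D) ∧ ∀ x ∈ D, ∀ y, |φ x y| ≤ g x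

/-- The sequence `w n ∈ L²(D)`, with scales `ε n`, two-scale converges to `w₀ ∈ L²(D × Y)`. -/
structure TwoScaleTendsto (D : Set E3) (ε : ℕ → ℝ) (w : ℕ → E3 → ℝ) (w₀ : E3 × E3 → ℝ) :
    Prop where
  memLp : ∀ n, MemLp (w n) 2 (volume.restrict D)
  memLp_limit : MemLp w₀ 2 (volDY D)
  tendsto : ∀ φ : E3 → E3 → ℝ, IsTwoScaleTest D φ →
    Tendsto (fun n => ∫ x in D, w n x * φ x ((ε n)⁻¹ • x)) atTop
      (𝓝 (∫ x in D, ∫ y in Y, w₀ (x, y) * φ x y))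

/-- Two-scale convergence of vector fields, componentwise. -/
def TwoScaleTendstoVec (D : Set E3) (ε : ℕ → ℝ) (w : ℕ → E3 → E3) (w₀ : E3 × E3 → E3) : Prop :=
  ∀ i : Fin 3, TwoScaleTendsto D ε (fun n x => w n x i) (fun p => w₀ p i)

end TwoScaleCurl

end

open TwoScaleCurl

noncomputable section

namespace TwoScaleCurl

/-! Periodic functions of the fast variable are treated as functions on the torus `TT`, so that
two-scale limits live in `L²(D; L²(𝕋³)³)` and Fourier series are available in `y`.

Compactness. For a test field `Φ ∈ L²(D; C(𝕋³)³)` the oscillating field `Φ(x, x/ε)` is bounded in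
`L²(D)` by the norm of `Φ`, and its `L²` norm converges to that of `Φ` over `D × 𝕋³`
(`tendsto_norm_sq_oscillate`, a consequence of the mean value property
`tendsto_integral_oscillating`). The functionals `Φ ↦ ∫ w^ε · Φ(x, x/ε)` therefore have a weak-*
limit along a subsequence, and this limit is bounded in the `L²(D × 𝕋³)` norm; Riesz represents it
(`exists_subseq_twoScale`). This gives limits `f` of the fields and `g` of their curls.

Structure in `y`. Testing the weak curl with `φ(x) exp(2πi k·x/ε) e_l` and multiplying by `ε` leaves
`k × f̂(x, k) = 0`. Testing with gradients, whose curl vanishes, gives `k · ĝ(x, k) = 0`. The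
Helmholtz decomposition on the torus (`helmholtz`: mean + gradient + curl, built from the
multipliers `∂ᵢΔ⁻¹` and `∂ᵢ∂ⱼΔ⁻¹`) then reduces `f(x, ·)` to its mean plus a gradient, and `g(x, ·)`
to its mean plus a curl. The potentials depend on the field through bounded operators, so they are
`L²` functions of `x`.

Structure in `x`. Test fields independent of `y` see only the means, and passing to the limit in the
weak curl identity shows that the mean of `g` is the weak curl of the mean of `f`
(`hasWeakCurl_mean`). The mean of `f` is `w₀`. -/

/-! ### The flat torus -/

/-- The torus `(ℝ/ℤ)³`. -/
abbrev TT : Type := UnitAddTorus (Fin 3)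

/-- The normalised Haar measure on the torus. -/
abbrev τ : Measure TT := Measure.pi fun _ => AddCircle.haarAddCircle

/-- The projection of `ℝ³` onto the torus. -/
def torusProj (y : E3) : TT := fun i => (y i : UnitAddCircle)

lemma continuous_torusProj : Continuous torusProj :=
  continuous_pi fun i => (AddCircle.continuous_mk' 1).comp (EuclideanSpace.proj (𝕜 := ℝ) i).continuous

/-- Open quotient maps, unlike general quotient maps, are stable under products; this is what later
lets a jointly continuous periodic function on `D × ℝ³` descend to `D × TT`. -/
lemma isOpenQuotientMap_torusProj : IsOpenQuotientMap torusProj := by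
  have h1 : IsOpenQuotientMap (Pi.map fun (_ : Fin 3) (t : ℝ) => (t : UnitAddCircle)) :=
    IsOpenQuotientMap.piMap fun _ => QuotientAddGroup.isOpenQuotientMap_mk
  exact h1.comp (EuclideanSpace.equiv (Fin 3) ℝ).toHomeomorph.isOpenQuotientMap

lemma torusProj_add_e (i : Fin 3) (y : E3) : torusProj (y + e i) = torusProj y := by
  funext j
  by_cases h : j = i
  · subst h
    simp [torusProj, e]
  · simp [torusProj, e, h]

lemma yPeriodic_comp_torusProj {F : Type} (u : TT → F) : YPeriodic (fun y => u (torusProj y)) :=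
  fun i y => by simp only [torusProj_add_e]

/-- A periodic function takes the same values at points with the same projection. -/
lemma YPeriodic.eq_of_torusProj_eq {F : Type} {u : E3 → F} (hu : YPeriodic u) {y z : E3}
    (h : torusProj y = torusProj z) : u y = u z := by
  have h1 : ∀ i : Fin 3, ∃ n : ℤ, (n : ℝ) = z i - y i := by
    intro i
    have := congrFun h i
    have h2 : ((z i - y i : ℝ) : UnitAddCircle) = 0 := by
      rw [AddCircle.coe_sub, sub_eq_zero]
      exact this.symm
    simpa using (AddCircle.coe_eq_zero_iff (1 : ℝ)).1 h2
  choose n hn using h1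
  have hp : ∀ (i : Fin 3) (m : ℤ) (x : E3), u (x + m • e i) = u x := fun i m x =>
    (show Function.Periodic u (e i) from hu i).zsmul m x
  have hz : z = y + n 0 • e 0 + n 1 • e 1 + n 2 • e 2 := by
    ext j
    fin_cases j <;> simp [e, hn]
  rw [hz, hp, hp, hp]

/-- The half-open unit cube with corner `a`. -/
def cube (a : E3) : Set E3 := {y | ∀ i, y i ∈ Ioc (a i) (a i + 1)}

lemma cube_eq_preimage (a : E3) : cube a =
    (MeasurableEquiv.toLp 2 (Fin 3 → ℝ)).symm ⁻¹' (Set.pi univ fun i => Ioc (a i) (a i + 1)) := by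
  ext; simp [cube]

/-- Every half-open unit cube is a fundamental domain. The corner is arbitrary because compact sets
will be covered by integer translates. -/
lemma measurePreserving_torusProj_cube (a : E3) :
    MeasurePreserving torusProj (volume.restrict (cube a)) τ := by
  have h1 : MeasurePreserving (MeasurableEquiv.toLp 2 (Fin 3 → ℝ)).symm (volume.restrict (cube a))
      (volume.restrict (Set.pi univ fun i => Ioc (a i) (a i + 1))) := by
    rw [cube_eq_preimage]
    exact (EuclideanSpace.volume_preserving_symm_measurableEquiv_toLp (Fin 3)).restrict_preimage
      (MeasurableSet.univ_pi fun _ => measurableSet_Ioc)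
  have h2 := measurePreserving_pi _ _ (fun i : Fin 3 => AddCircle.measurePreserving_mk 1 (a i))
  rw [← Measure.restrict_pi_pi] at h2
  have h3 : (Measure.pi fun _ : Fin 3 => (volume : Measure UnitAddCircle)) = τ := by
    simp [τ, AddCircle.volume_eq_smul_haarAddCircle]
  rw [h3] at h2
  exact h2.comp h1

lemma restrict_Y_eq : volume.restrict Y = volume.restrict (cube 0) := by
  refine Measure.restrict_congr_set ?_
  have : (Set.pi univ fun _ : Fin 3 => Ioo (0 : ℝ) 1) =ᵐ[volume]
      Set.pi univ fun _ : Fin 3 => Ioc (0 : ℝ) 1 := by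
    exact Measure.ae_eq_set_pi fun i _ => Ioo_ae_eq_Ioc
  have h2 := (EuclideanSpace.volume_preserving_symm_measurableEquiv_toLp
    (Fin 3)).quasiMeasurePreserving.preimage_ae_eq this
  have hY : Y = (MeasurableEquiv.toLp 2 (Fin 3 → ℝ)).symm ⁻¹' (Set.pi univ fun _ => Ioo (0 : ℝ) 1) := by
    ext; simp [Y]
  rw [hY, cube_eq_preimage]
  simpa using h2

lemma measurePreserving_torusProj : MeasurePreserving torusProj (volume.restrict Y) τ := by
  rw [restrict_Y_eq]
  exact measurePreserving_torusProj_cube 0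

/-- The exponential monomials in coordinates. -/
lemma mFourier_torusProj (k : Fin 3 → ℤ) (y : E3) :
    UnitAddTorus.mFourier k (torusProj y) =
      Complex.exp (2 * Real.pi * Complex.I * (k 0 * y 0 + k 1 * y 1 + k 2 * y 2 : ℝ)) := by
  simp only [UnitAddTorus.mFourier, torusProj, ContinuousMap.coe_mk, fourier_coe_apply,
    Fin.prod_univ_three, ← Complex.exp_add]
  congr 1
  push_cast
  ring

/-- Projecting a compact set to the torus increases measure at most by a constant factor. -/
lemma exists_map_torusProj_le {K : Set E3} (hK : IsCompact K) :
    ∃ c : ENNReal, c ≠ ⊤ ∧ (volume.restrict K).map torusProj ≤ c • τ := by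
  obtain ⟨N, hN⟩ : ∃ N : ℕ, ∀ x ∈ K, ∀ i, |x i| ≤ N := by
    obtain ⟨R, hR⟩ := hK.isBounded.exists_norm_le
    obtain ⟨N, hN⟩ := exists_nat_ge R
    exact ⟨N, fun x hx i => (PiLp.norm_apply_le x i).trans ((hR x hx).trans hN)⟩
  let S : Finset (Fin 3 → ℤ) := Fintype.piFinset fun _ => Finset.Icc (-(N : ℤ) - 1) N
  have hcov : K ⊆ ⋃ n ∈ S, cube (WithLp.toLp 2 fun i => (n i : ℝ)) := by
    intro x hx
    simp only [mem_iUnion]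
    -- The cubes omit their lower faces, so the corner of the cube containing `x` is `⌈x i⌉ - 1`;
    -- this accounts for the lower bound `-N - 1` in `S`.
    refine ⟨fun i => ⌈x i⌉ - 1, ?_, fun i => ?_⟩
    · simp only [S, Fintype.mem_piFinset, Finset.mem_Icc]
      intro i
      have := abs_le.1 (hN x hx i)
      constructor
      · have : (-(N : ℤ)) ≤ ⌈x i⌉ := by
          have h := Int.le_ceil (x i)
          have : (-(N : ℤ) : ℝ) ≤ ⌈x i⌉ := by push_cast; linarith
          exact_mod_cast this
        omega
      · have : ⌈x i⌉ ≤ (N : ℤ) := Int.ceil_le.2 (by exact_mod_cast this.2)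
        omega
    · simp only [mem_Ioc]
      push_cast
      exact ⟨by linarith [Int.ceil_lt_add_one (x i)], by linarith [Int.le_ceil (x i)]⟩
  refine ⟨S.card, by simp, Measure.le_iff.2 fun A hA => ?_⟩
  have hA' := continuous_torusProj.measurable hA
  rw [Measure.map_apply continuous_torusProj.measurable hA, Measure.restrict_apply hA']
  calc volume (torusProj ⁻¹' A ∩ K)
      ≤ volume (⋃ n ∈ S, torusProj ⁻¹' A ∩ cube (WithLp.toLp 2 fun i => (n i : ℝ))) := by
        refine measure_mono fun x hx => ?_
        have := hcov hx.2
        simp only [mem_iUnion] at this ⊢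
        obtain ⟨n, hn, h⟩ := this
        exact ⟨n, hn, hx.1, h⟩
    _ ≤ ∑ n ∈ S, volume (torusProj ⁻¹' A ∩ cube (WithLp.toLp 2 fun i => (n i : ℝ))) :=
        measure_biUnion_finset_le _ _
    _ = ∑ n ∈ S, τ A := by
        refine Finset.sum_congr rfl fun n _ => ?_
        rw [← Measure.restrict_apply hA']
        exact (measurePreserving_torusProj_cube _).measure_preimage hA.nullMeasurableSet
    _ = _ := by simp

/-! ### The mean value property of periodic functions -/

lemma tendsto_inv_scale {ε : ℕ → ℝ} (hε : ∀ n, 0 < ε n) (hε0 : Tendsto ε atTop (𝓝 0)) :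
    Tendsto (fun n => (ε n)⁻¹) atTop atTop :=
  tendsto_inv_nhdsGT_zero.comp (tendsto_nhdsWithin_iff.2 ⟨hε0, Eventually.of_forall hε⟩)

/-- Orthonormality of the monomials, applied to the constant monomial and the `k`-th one. -/
lemma integral_mFourier (k : Fin 3 → ℤ) :
    ∫ t, UnitAddTorus.mFourier k t ∂τ = if k = 0 then 1 else 0 := by
  have h := orthonormal_iff_ite.1 (UnitAddTorus.orthonormal_mFourier (d := Fin 3)) 0 k
  rw [ContinuousMap.inner_toLp] at h
  simpa [UnitAddTorus.mFourier_zero, eq_comm] using! h.symm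

/-- For `k ≠ 0` this is the Riemann–Lebesgue lemma for the indicator of `A` at the frequencies `s n
• k`. If `A` has infinite volume both sides are `0` by the conventions for `volume.real` and
non-integrable functions. -/
lemma tendsto_setIntegral_mFourier {s : ℕ → ℝ} (hs : Tendsto s atTop atTop) {A : Set E3}
    (hA : MeasurableSet A) (k : Fin 3 → ℤ) :
    Tendsto (fun n => ∫ x in A, UnitAddTorus.mFourier k (torusProj (s n • x))) atTop
      (𝓝 (volume.real A • ∫ t, UnitAddTorus.mFourier k t ∂τ)) := by
  rw [integral_mFourier]
  by_cases hk : k = 0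
  · subst hk
    simp [UnitAddTorus.mFourier_zero, Complex.real_smul]
  · rw [if_neg hk, smul_zero]
    -- The sign compensates for the minus sign in the kernel of the Fourier transform.
    set v : E3 := WithLp.toLp 2 fun i => -(k i : ℝ) with hv
    have hv0 : v ≠ 0 := by
      intro h
      apply hk
      funext i
      have := congrArg (fun z : E3 => z i) h
      simpa [hv] using this
    have h1 : Tendsto (fun n => s n • v) atTop (cocompact E3) := by
      rw [← Metric.cobounded_eq_cocompact, ← comap_norm_atTop, tendsto_comap_iff]
      simp only [Function.comp_def, norm_smul]
      exact (tendsto_norm_atTop_atTop.comp hs).atTop_mul_const (norm_pos_iff.2 hv0)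
    have h2 := (tendsto_integral_exp_inner_smul_cocompact (V := E3)
      (A.indicator fun _ => (1 : ℂ))).comp h1
    refine h2.congr fun n => ?_
    simp only [Function.comp]
    rw [← integral_indicator hA]
    refine integral_congr_ae (ae_of_all _ fun x => ?_)
    by_cases hx : x ∈ A
    · simp only [indicator_of_mem hx, mFourier_torusProj, Circle.smul_def, Real.fourierChar_apply]
      rw [smul_eq_mul, mul_one]
      congr 1
      rw [inner_smul_right]
      simp [hv, PiLp.inner_apply, Fin.sum_univ_three]
      ring
    · simp [indicator_of_notMem hx]

lemma norm_integral_torus_le {F : Type} [NormedAddCommGroup F] [NormedSpace ℝ F] (c : C(TT, F)) :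
    ‖∫ t, c t ∂τ‖ ≤ ‖c‖ := by
  simpa using norm_integral_le_of_norm_le_const (μ := τ) (f := c) (C := ‖c‖)
    (ae_of_all _ fun t => c.norm_coe_le_norm t)

lemma integrable_torus {F : Type} [NormedAddCommGroup F] (c : C(TT, F)) :
    Integrable c τ :=
  c.continuous.integrable_of_hasCompactSupport (HasCompactSupport.of_compactSpace c)

/-- The integral over the torus, as a continuous linear map. -/
def torusIntegral (F : Type) [NormedAddCommGroup F] [NormedSpace ℝ F] : C(TT, F) →L[ℝ] F :=
  LinearMap.mkContinuous
    { toFun := fun c => ∫ t, c t ∂τ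
      map_add' := fun c d => integral_add (integrable_torus c) (integrable_torus d)
      map_smul' := fun a c => integral_smul a c } 1
    (fun c => by simpa using norm_integral_torus_le c)

lemma continuous_eval_torusProj {F : Type} [TopologicalSpace F] (s : ℝ) (c : C(TT, F)) :
    Continuous fun x : E3 => c (torusProj (s • x)) :=
  c.continuous.comp (continuous_torusProj.comp (continuous_const_smul s))

/-- The functionals are Lipschitz in `c` with the common constant `volume.real A`, so the set of `c`
for which convergence holds is closed. It contains the trigonometric polynomials, which are dense in
`C(TT, ℂ)`. -/
lemma tendsto_setIntegral_periodic {s : ℕ → ℝ} (hs : Tendsto s atTop atTop) {A : Set E3}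
    (hA : MeasurableSet A) (hA' : volume A ≠ ⊤) (c : C(TT, ℂ)) :
    Tendsto (fun n => ∫ x in A, c (torusProj (s n • x))) atTop
      (𝓝 (volume.real A • ∫ t, c t ∂τ)) := by
  have hfin : IsFiniteMeasure (volume.restrict A) := ⟨by simpa using hA'.lt_top⟩
  have hint : ∀ (c : C(TT, ℂ)) (r : ℝ),
      Integrable (fun x : E3 => c (torusProj (r • x))) (volume.restrict A) := fun c r =>
    Integrable.of_bound (continuous_eval_torusProj r c).aestronglyMeasurable ‖c‖
      (ae_of_all _ fun x => c.norm_coe_le_norm _)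
  have hcl : IsClosed {c : C(TT, ℂ) | Tendsto (fun n => ∫ x in A, c (torusProj (s n • x))) atTop
      (𝓝 (volume.real A • ∫ t, c t ∂τ))} := by
    refine Equicontinuous.isClosed_setOfPred_tendsto
      (F := fun n (c : C(TT, ℂ)) => ∫ x in A, c (torusProj (s n • x)))
      (f := fun c : C(TT, ℂ) => volume.real A • ∫ t, c t ∂τ) ?_ ?_
    · refine UniformEquicontinuous.equicontinuous
        (LipschitzWith.uniformEquicontinuous
        (fun n (c : C(TT, ℂ)) => ∫ x in A, c (torusProj (s n • x))) (volume.real A).toNNReal fun n =>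
          LipschitzWith.of_dist_le_mul fun c d => ?_)
      rw [dist_eq_norm, dist_eq_norm, ← integral_sub (hint c _) (hint d _),
        Real.coe_toNNReal _ measureReal_nonneg, mul_comm]
      refine norm_setIntegral_le_of_norm_le_const hA'.lt_top fun x _ => ?_
      exact (c - d).norm_coe_le_norm _
    · exact (continuous_const_smul (volume.real A)).comp (torusIntegral ℂ).continuous
  have hspan : ((Submodule.span ℂ (range (UnitAddTorus.mFourier (d := Fin 3))) :
      Submodule ℂ C(TT, ℂ)) : Set C(TT, ℂ)) ⊆
      {c : C(TT, ℂ) | Tendsto (fun n => ∫ x in A, c (torusProj (s n • x))) atTop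
      (𝓝 (volume.real A • ∫ t, c t ∂τ))} := by
    intro c hc
    refine Submodule.span_induction ?_ ?_ ?_ ?_ hc
    · rintro _ ⟨k, rfl⟩
      exact tendsto_setIntegral_mFourier hs hA k
    · simp
    · intro c d _ _ h1 h2
      have := h1.add h2
      rw [mem_ofPred_eq]
      simp only [ContinuousMap.add_apply]
      rw [integral_add (integrable_torus c) (integrable_torus d), smul_add]
      refine this.congr fun n => ?_
      rw [integral_add (hint c _) (hint d _)]
    · intro a c _ h
      have : Tendsto _ _ _ := Tendsto.const_smul (show Tendsto _ _ _ from h) a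
      rw [mem_ofPred_eq]
      simp only [ContinuousMap.smul_apply, integral_smul]
      rwa [smul_comm (volume.real A) a (∫ t, c t ∂τ)]
  have := closure_minimal hspan hcl
  rw [← Submodule.topologicalClosure_coe, UnitAddTorus.span_mFourier_closure_eq_top] at this
  exact this (mem_univ c)

lemma aestronglyMeasurable_eval {F : Type} [NormedAddCommGroup F] {μ : Measure E3} (s : ℝ)
    {Ψ : E3 → C(TT, F)} (hΨ : AEStronglyMeasurable Ψ μ) :
    AEStronglyMeasurable (fun x => Ψ x (torusProj (s • x))) μ := by
  have h1 : AEStronglyMeasurable (fun x => (Ψ x, torusProj (s • x))) μ :=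
    hΨ.prodMk (continuous_torusProj.comp (continuous_const_smul s)).aestronglyMeasurable
  exact (continuous_eval (F := C(TT, F))).comp_aestronglyMeasurable h1

/-- The mean value property: rapidly oscillating periodic functions average out. -/
lemma tendsto_integral_oscillating {s : ℕ → ℝ} (hs : Tendsto s atTop atTop) {D : Set E3}
    {Ψ : E3 → C(TT, ℂ)} (hΨ : Integrable Ψ (volume.restrict D)) :
    Tendsto (fun n => ∫ x in D, Ψ x (torusProj (s n • x))) atTop
      (𝓝 (∫ x in D, torusIntegral ℂ (Ψ x))) := by
  have hint : ∀ {Ψ : E3 → C(TT, ℂ)} (r : ℝ), Integrable Ψ (volume.restrict D) →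
      Integrable (fun x => Ψ x (torusProj (r • x))) (volume.restrict D) := fun r h =>
    h.norm.mono' (aestronglyMeasurable_eval r h.1) (ae_of_all _ fun x => (_ : C(TT, ℂ)).norm_coe_le_norm _)
  -- Indicator functions are covered by `tendsto_setIntegral_periodic`. The functionals are
  -- 1-Lipschitz on `L¹(D; C(TT, ℂ))` uniformly in `n`, so the property survives `L¹` limits.
  refine Integrable.induction (P := fun Ψ : E3 → C(TT, ℂ) =>
    Tendsto (fun n => ∫ x in D, Ψ x (torusProj (s n • x))) atTop
      (𝓝 (∫ x in D, torusIntegral ℂ (Ψ x)))) ?_ ?_ ?_ ?_ hΨ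
  · intro c A hA hA'
    rw [Measure.restrict_apply hA] at hA'
    -- `D` is an arbitrary set here, so `A ∩ D` is replaced by a measurable hull, which carries the
    -- same restricted measure.
    obtain ⟨B, hB, hBm, hBe⟩ : ∃ B, MeasurableSet B ∧ volume B ≠ ⊤ ∧
        (volume.restrict D).restrict A = volume.restrict B := by
      refine ⟨toMeasurable volume (A ∩ D), measurableSet_toMeasurable _ _, ?_, ?_⟩
      · rw [measure_toMeasurable]; exact hA'.ne
      · rw [Measure.restrict_restrict hA, Measure.restrict_toMeasurable hA'.ne]
    have h := tendsto_setIntegral_periodic hs hB hBm c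
    have e1 : ∀ n, ∫ x in D, (A.indicator (fun _ => c) x) (torusProj (s n • x)) =
        ∫ x in B, c (torusProj (s n • x)) := by
      intro n
      rw [← hBe, ← integral_indicator hA]
      congr 1
      funext x
      by_cases hx : x ∈ A <;> simp [hx]
    have e2 : ∫ x in D, torusIntegral ℂ (A.indicator (fun _ => c) x) =
        volume.real B • ∫ t, c t ∂τ := by
      have : ∀ x, torusIntegral ℂ (A.indicator (fun _ => c) x) =
          A.indicator (fun _ => torusIntegral ℂ c) x := by
        intro x
        by_cases hx : x ∈ A <;> simp [hx]
      simp only [this]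
      rw [integral_indicator hA, hBe, setIntegral_const]
      rfl
    simp only [e1, e2]
    exact h
  · intro f g _ hf hg h1 h2
    simp only [Pi.add_apply, map_add, ContinuousMap.add_apply]
    rw [integral_add ((torusIntegral ℂ).integrable_comp hf) ((torusIntegral ℂ).integrable_comp hg)]
    refine (h1.add h2).congr fun n => ?_
    rw [integral_add (hint _ hf) (hint _ hg)]
  · refine Equicontinuous.isClosed_setOfPred_tendsto
      (F := fun n (f : Lp C(TT, ℂ) 1 (volume.restrict D)) => ∫ x in D, f x (torusProj (s n • x)))
      (f := fun f : Lp C(TT, ℂ) 1 (volume.restrict D) => ∫ x in D, torusIntegral ℂ (f x)) ?_ ?_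
    · refine UniformEquicontinuous.equicontinuous
        (LipschitzWith.uniformEquicontinuous _ 1 fun n =>
          LipschitzWith.of_dist_le_mul fun f g => ?_)
      rw [dist_eq_norm, dist_eq_norm, ← integral_sub (hint _ (L1.integrable_coeFn f))
        (hint _ (L1.integrable_coeFn g)), L1.norm_eq_integral_norm, NNReal.coe_one, one_mul]
      refine norm_integral_le_of_norm_le (L1.integrable_coeFn (f - g)).norm ?_
      filter_upwards [Lp.coeFn_sub f g] with x hx
      rw [hx]
      exact (f x - g x).norm_coe_le_norm _
    · exact (continuous_integral).comp ((torusIntegral ℂ).compLpL 1 _).continuous |>.congr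
        fun f => by
          refine integral_congr_ae ?_
          exact (torusIntegral ℂ).coeFn_compLpL f
  · intro f g hfg hf h
    have e1 : ∀ n, ∫ x in D, f x (torusProj (s n • x)) = ∫ x in D, g x (torusProj (s n • x)) :=
      fun n => integral_congr_ae (hfg.mono fun x hx => by simp only [hx])
    have e2 : ∫ x in D, torusIntegral ℂ (f x) = ∫ x in D, torusIntegral ℂ (g x) :=
      integral_congr_ae (hfg.mono fun x hx => by simp only [hx])
    simpa only [e1, e2] using h

/-! ### Weak two-scale compactness -/

lemma memLp_oscillate {D : Set E3} (s : ℝ) {Φ : E3 → C(TT, E3)}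
    (h : MemLp Φ 2 (volume.restrict D)) :
    MemLp (fun x => Φ x (torusProj (s • x))) 2 (volume.restrict D) :=
  h.of_le (aestronglyMeasurable_eval s h.1) (ae_of_all _ fun x => (Φ x).norm_coe_le_norm _)

/-- The operator `Φ ↦ Φ(x, s x)`, `L²(D; C(𝕋³)³) → L²(D)³`. -/
def oscillate (D : Set E3) (s : ℝ) : L2 D C(TT, E3) →L[ℝ] L2 D E3 :=
  LinearMap.mkContinuous
    { toFun := fun Φ => (memLp_oscillate s (Lp.memLp Φ)).toLp _
      map_add' := fun Φ Ψ => by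
        rw [← MemLp.toLp_add]
        refine MemLp.toLp_congr _ _ ?_
        filter_upwards [Lp.coeFn_add Φ Ψ] with x hx
        rw [hx]
        rfl
      map_smul' := fun a Φ => by
        rw [RingHom.id_apply, ← MemLp.toLp_const_smul]
        refine MemLp.toLp_congr _ _ ?_
        filter_upwards [Lp.coeFn_smul a Φ] with x hx
        rw [hx]
        rfl } 1
    (fun Φ => by
      rw [one_mul]
      refine Lp.norm_le_norm_of_ae_le ?_
      filter_upwards [(memLp_oscillate s (Lp.memLp Φ)).coeFn_toLp] with x hx
      simp only [LinearMap.coe_mk, AddHom.coe_mk]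
      rw [hx]
      exact (Φ x).norm_coe_le_norm _)

lemma coeFn_oscillate {D : Set E3} (s : ℝ) (Φ : L2 D C(TT, E3)) :
    oscillate D s Φ =ᵐ[volume.restrict D] fun x => Φ x (torusProj (s • x)) :=
  (memLp_oscillate s (Lp.memLp Φ)).coeFn_toLp

lemma norm_oscillate_le {D : Set E3} (s : ℝ) (Φ : L2 D C(TT, E3)) : ‖oscillate D s Φ‖ ≤ ‖Φ‖ := by
  refine Lp.norm_le_norm_of_ae_le ?_
  filter_upwards [coeFn_oscillate s Φ] with x hx
  rw [hx]
  exact (Φ x).norm_coe_le_norm _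

/-- The inclusion `L²(D; C(𝕋³)³) → L²(D; L²(𝕋³)³)`. -/
def toTwoScale (D : Set E3) : L2 D C(TT, E3) →L[ℝ] L2 D (Lp E3 2 τ) :=
  (ContinuousMap.toLp 2 τ ℝ : C(TT, E3) →L[ℝ] Lp E3 2 τ).compLpL 2 (volume.restrict D)

lemma coeFn_toTwoScale {D : Set E3} (Φ : L2 D C(TT, E3)) :
    toTwoScale D Φ =ᵐ[volume.restrict D] fun x => (ContinuousMap.toLp 2 τ ℝ (Φ x) : Lp E3 2 τ) :=
  ContinuousLinearMap.coeFn_compLpL _ _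

/-- Postcomposition with the squared norm. -/
def normSqMap (c : C(TT, E3)) : C(TT, ℂ) := ⟨fun t => ((‖c t‖ ^ 2 : ℝ) : ℂ), by fun_prop⟩

lemma continuous_normSqMap : Continuous normSqMap := by
  have : Continuous fun v : E3 => ((‖v‖ ^ 2 : ℝ) : ℂ) := by fun_prop
  exact ContinuousMap.continuous_postcomp (⟨_, this⟩ : C(E3, ℂ))

lemma norm_normSqMap_le (c : C(TT, E3)) : ‖normSqMap c‖ ≤ ‖c‖ ^ 2 := by
  refine (ContinuousMap.norm_le _ (by positivity)).2 fun t => ?_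
  have := c.norm_coe_le_norm t
  simp only [normSqMap, ContinuousMap.coe_mk, Complex.norm_real, norm_pow, norm_norm]
  gcongr

/-- The mean value property applied to `‖Φ(x, ·)‖²`, which is in `L¹(D; C(TT, ℂ))`. It replaces the
supremum over `y` by the `L²` norm in `y` when bounding the limit functional. -/
lemma tendsto_norm_sq_oscillate {s : ℕ → ℝ} (hs : Tendsto s atTop atTop) {D : Set E3}
    (Φ : L2 D C(TT, E3)) :
    Tendsto (fun n => ‖oscillate D (s n) Φ‖ ^ 2) atTop (𝓝 (‖toTwoScale D Φ‖ ^ 2)) := by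
  have hint : Integrable (fun x => normSqMap (Φ x)) (volume.restrict D) := by
    refine ((Lp.memLp Φ).integrable_norm_pow (by simp)).mono'
      (continuous_normSqMap.comp_aestronglyMeasurable (Lp.aestronglyMeasurable Φ)) ?_
    exact ae_of_all _ fun x => by simpa using norm_normSqMap_le (Φ x)
  have h := Complex.continuous_re.tendsto _ |>.comp (tendsto_integral_oscillating hs hint)
  have e1 : ∀ n, (∫ x in D, normSqMap (Φ x) (torusProj (s n • x))) =
      ((‖oscillate D (s n) Φ‖ ^ 2 : ℝ) : ℂ) := by
    intro n
    rw [← real_inner_self_eq_norm_sq, L2.inner_def, ← integral_complex_ofReal]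
    refine integral_congr_ae ?_
    filter_upwards [coeFn_oscillate (s n) Φ] with x hx
    rw [hx, real_inner_self_eq_norm_sq]
    rfl
  have e2 : (∫ x in D, torusIntegral ℂ (normSqMap (Φ x))) = ((‖toTwoScale D Φ‖ ^ 2 : ℝ) : ℂ) := by
    rw [← real_inner_self_eq_norm_sq, L2.inner_def, ← integral_complex_ofReal]
    refine integral_congr_ae ?_
    filter_upwards [coeFn_toTwoScale Φ] with x hx
    rw [hx, L2.inner_def, ← integral_complex_ofReal]
    refine integral_congr_ae ?_
    filter_upwards [ContinuousMap.coeFn_toLp (𝕜 := ℝ) (p := 2) τ (Φ x)] with t ht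
    rw [ht, real_inner_self_eq_norm_sq]
    rfl
  rw [e2] at h
  simpa only [Function.comp_def, e1, Complex.ofReal_re] using h

/-- The bound makes `L` vanish on the kernel of `J`, so `L` factors through a bounded functional on
the range of `J`; Hahn–Banach extends it to `H` and Riesz represents the extension. -/
lemma exists_inner_eq_of_norm_le {X H : Type} [NormedAddCommGroup X] [NormedSpace ℝ X]
    [NormedAddCommGroup H] [InnerProductSpace ℝ H] [CompleteSpace H] (L : X →ₗ[ℝ] ℝ) (J : X →ₗ[ℝ] H)
    (C : ℝ) (h : ∀ x, |L x| ≤ C * ‖J x‖) : ∃ f : H, ∀ x, L x = inner ℝ f (J x) := by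
  have hker : LinearMap.ker J ≤ LinearMap.ker L := by
    intro x hx
    have := h x
    rw [LinearMap.mem_ker.1 hx] at this
    simpa using this
  let M : LinearMap.range J →ₗ[ℝ] ℝ :=
    (LinearMap.ker J).liftQ L hker ∘ₗ J.quotKerEquivRange.symm.toLinearMap
  have hM : ∀ x, M ⟨J x, x, rfl⟩ = L x := by
    intro x
    have : J.quotKerEquivRange.symm ⟨J x, x, rfl⟩ = (LinearMap.ker J).mkQ x := by
      rw [LinearEquiv.symm_apply_eq]
      rfl
    simp only [M, LinearMap.comp_apply, LinearEquiv.coe_coe, this]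
    rfl
  have hM' : ∀ y, ‖M y‖ ≤ C * ‖y‖ := by
    rintro ⟨_, x, rfl⟩
    rw [hM]
    exact h x
  obtain ⟨g, hg, -⟩ := exists_extension_norm_eq (LinearMap.range J) (M.mkContinuous C hM')
  refine ⟨(InnerProductSpace.toDual ℝ H).symm g, fun x => ?_⟩
  rw [InnerProductSpace.toDual_symm_apply, ← hM x]
  exact (hg ⟨J x, x, rfl⟩).symm

/-- Weak two-scale compactness of bounded sequences in `L²(D)³`. -/
theorem exists_subseq_twoScale {s : ℕ → ℝ} (hs : Tendsto s atTop atTop) {D : Set E3}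
    (w : ℕ → L2 D E3) {C : ℝ} (hw : ∀ n, ‖w n‖ ≤ C) :
    ∃ k : ℕ → ℕ, StrictMono k ∧ ∃ f : L2 D (Lp E3 2 τ), ∀ Φ : L2 D C(TT, E3),
      Tendsto (fun n => inner ℝ (w (k n)) (oscillate D (s (k n)) Φ)) atTop
        (𝓝 (inner ℝ f (toTwoScale D Φ))) := by
  have hC : 0 ≤ C := (norm_nonneg _).trans (hw 0)
  let L : ℕ → StrongDual ℝ (L2 D C(TT, E3)) := fun n => (innerSL ℝ (w n)).comp (oscillate D (s n))
  have hL : ∀ n Φ, |L n Φ| ≤ C * ‖oscillate D (s n) Φ‖ := fun n Φ =>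
    (abs_real_inner_le_norm _ _).trans (mul_le_mul_of_nonneg_right (hw n) (norm_nonneg _))
  have hL' : ∀ n, ‖L n‖ ≤ C := fun n => (L n).opNorm_le_bound hC fun Φ =>
    (hL n Φ).trans (by gcongr; exact norm_oscillate_le _ _)
  have : Fact ((2 : ENNReal) ≠ ⊤) := ⟨by simp⟩
  -- Separability of the space of test fields makes dual balls sequentially weak-* compact.
  have : SecondCountableTopology (L2 D C(TT, E3)) := Lp.SecondCountableTopology
  obtain ⟨M, -, k, hk, hM⟩ := WeakDual.isSeqCompact_closedBall ℝ (L2 D C(TT, E3)) 0 C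
    (x := fun n => StrongDual.toWeakDual (L n)) (fun n => by simpa using hL' n)
  have hM' : ∀ Φ, Tendsto (fun n => L (k n) Φ) atTop (𝓝 (M Φ)) := fun Φ =>
    ((WeakDual.eval_continuous Φ).tendsto M).comp hM
  -- The bound by `C * ‖oscillate D (s n) Φ‖` is kept along the sequence, and the norm on its right
  -- converges.
  have hbound : ∀ Φ, |M Φ| ≤ C * ‖toTwoScale D Φ‖ := by
    intro Φ
    have h1 := (tendsto_norm_sq_oscillate hs Φ).sqrt
    simp only [Real.sqrt_sq (norm_nonneg _)] at h1
    exact le_of_tendsto_of_tendsto' (hM' Φ).abs ((h1.comp hk.tendsto_atTop).const_mul C)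
      fun n => hL _ _
  obtain ⟨f, hf⟩ := exists_inner_eq_of_norm_le (WeakDual.toStrongDual M).toLinearMap
    (toTwoScale D).toLinearMap C hbound
  refine ⟨k, hk, f, fun Φ => ?_⟩
  have := hf Φ
  simp only [ContinuousLinearMap.coe_coe] at this
  rw [← this]
  exact hM' Φ

/-! ### Functions in `L²(D; L²(Y))` as functions of two variables -/

section Uncurry

variable {α β : Type} [MeasurableSpace α] [MeasurableSpace β] {μ : Measure α} {ν : Measure β}
  [SFinite ν] {E : Type} [NormedAddCommGroup E]

/-- `F ∈ L²(μ ⊗ ν)` is the function of two variables given by `f ∈ L²(μ; L²(ν))`. -/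
def IsUncurry (f : Lp (Lp E 2 ν) 2 μ) (F : Lp E 2 (μ.prod ν)) : Prop :=
  ∀ᵐ x ∂μ, ∀ᵐ y ∂ν, F (x, y) = f x y

lemma IsUncurry.add {f g : Lp (Lp E 2 ν) 2 μ} {F G : Lp E 2 (μ.prod ν)} (h : IsUncurry f F)
    (h' : IsUncurry g G) : IsUncurry (f + g) (F + G) := by
  filter_upwards [h, h', Lp.coeFn_add f g, Measure.ae_ae_of_ae_prod (Lp.coeFn_add F G)]
    with x hx hx' hfg hFG
  rw [hfg]
  filter_upwards [hx, hx', hFG, Lp.coeFn_add (f x) (g x)] with y h1 h2 h3 h4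
  rw [h3, Pi.add_apply, Pi.add_apply, h4, Pi.add_apply, h1, h2]

lemma IsUncurry.sub {f g : Lp (Lp E 2 ν) 2 μ} {F G : Lp E 2 (μ.prod ν)} (h : IsUncurry f F)
    (h' : IsUncurry g G) : IsUncurry (f - g) (F - G) := by
  filter_upwards [h, h', Lp.coeFn_sub f g, Measure.ae_ae_of_ae_prod (Lp.coeFn_sub F G)]
    with x hx hx' hfg hFG
  rw [hfg]
  filter_upwards [hx, hx', hFG, Lp.coeFn_sub (f x) (g x)] with y h1 h2 h3 h4
  rw [h3, Pi.sub_apply, Pi.sub_apply, h4, Pi.sub_apply, h1, h2]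

variable [InnerProductSpace ℝ E]

lemma Lp.norm_sq_eq_integral {γ : Type} [MeasurableSpace γ] {κ : Measure γ} {E : Type}
    [NormedAddCommGroup E] [InnerProductSpace ℝ E] (f : Lp E 2 κ) :
    ‖f‖ ^ 2 = ∫ x, ‖f x‖ ^ 2 ∂κ := by
  rw [← real_inner_self_eq_norm_sq, L2.inner_def]
  simp only [real_inner_self_eq_norm_sq]

lemma Lp.integrable_norm_sq {γ : Type} [MeasurableSpace γ] {κ : Measure γ} {E : Type}
    [NormedAddCommGroup E] (f : Lp E 2 κ) : Integrable (fun x => ‖f x‖ ^ 2) κ :=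
  (Lp.memLp f).integrable_norm_pow (by simp)

lemma exists_isUncurry_indicator (c : Lp E 2 ν) {s : Set α} (hs : MeasurableSet s)
    (hμs : μ s < ⊤) : ∃ F, IsUncurry (indicatorConstLp 2 hs hμs.ne c : Lp (Lp E 2 ν) 2 μ) F := by
  have hm : MemLp (fun p : α × β => s.indicator (fun _ => (1 : ℝ)) p.1 • c p.2) 2 (μ.prod ν) := by
    have h1 : AEStronglyMeasurable (fun p : α × β => s.indicator (fun _ => (1 : ℝ)) p.1)
        (μ.prod ν) :=
      ((stronglyMeasurable_const.indicator hs).comp_measurable measurable_fst).aestronglyMeasurable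
    have h2 : AEStronglyMeasurable (fun p : α × β => c p.2) (μ.prod ν) :=
      (Lp.aestronglyMeasurable c).comp_snd
    refine (memLp_two_iff_integrable_sq_norm (h1.smul h2)).2 ?_
    have h3 : Integrable (s.indicator fun _ => (1 : ℝ)) μ :=
      (integrable_indicator_iff hs).2 (integrableOn_const (hμs.ne))
    refine (h3.mul_prod (Lp.integrable_norm_sq c)).congr (ae_of_all _ fun p => ?_)
    by_cases hp : p.1 ∈ s <;> simp [hp]
  refine ⟨hm.toLp _, ?_⟩
  filter_upwards [Measure.ae_ae_of_ae_prod hm.coeFn_toLp,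
    (indicatorConstLp_coeFn : indicatorConstLp 2 hs hμs.ne c =ᵐ[μ] _)] with x h1 h2
  rw [h2]
  by_cases hx : x ∈ s
  · filter_upwards [h1] with y hy
    rw [hy]
    simp [hx]
  · filter_upwards [h1, Lp.coeFn_zero E 2 ν] with y hy hy'
    rw [hy, indicator_of_notMem hx, indicator_of_notMem hx, zero_smul]
    exact hy'.symm

variable [SFinite μ]

/-- Fubini. The isometry turns convergent sequences of `f`'s into Cauchy sequences of `F`'s in
`exists_isUncurry`. -/
lemma IsUncurry.norm_eq {f : Lp (Lp E 2 ν) 2 μ} {F : Lp E 2 (μ.prod ν)} (h : IsUncurry f F) :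
    ‖F‖ = ‖f‖ := by
  rw [← sq_eq_sq₀ (norm_nonneg _) (norm_nonneg _), Lp.norm_sq_eq_integral, Lp.norm_sq_eq_integral,
    integral_prod _ (Lp.integrable_norm_sq F)]
  refine integral_congr_ae ?_
  filter_upwards [h] with x hx
  rw [Lp.norm_sq_eq_integral]
  refine integral_congr_ae ?_
  filter_upwards [hx] with y hy
  rw [hy]

/-- Along a subsequence, for almost every `x`, the slices `f n x` converge in `L²(ν)` both to `g x`
and to `G(x, ·)`. The second convergence holds because the squared slice distances `H` tend to zero
in `L¹(μ)`, which requires a further extraction. -/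
lemma isUncurry_of_tendsto {f : ℕ → Lp (Lp E 2 ν) 2 μ} {g : Lp (Lp E 2 ν) 2 μ}
    {F : ℕ → Lp E 2 (μ.prod ν)} {G : Lp E 2 (μ.prod ν)} (h : ∀ n, IsUncurry (f n) (F n))
    (hf : Tendsto f atTop (𝓝 g)) (hF : Tendsto F atTop (𝓝 G)) : IsUncurry g G := by
  obtain ⟨k, hk, hk'⟩ := (tendstoInMeasure_of_tendsto_Lp hf).exists_seq_tendsto_ae
  let H : ℕ → α → ℝ := fun n x => ∫ y, ‖(F (k n) - G) (x, y)‖ ^ 2 ∂ν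
  have hHi : ∀ n, Integrable (H n) μ := fun n =>
    (Lp.integrable_norm_sq (F (k n) - G)).integral_prod_left
  have hH0 : ∀ n x, 0 ≤ H n x := fun n x => integral_nonneg fun y => by positivity
  have hHn : ∀ n, eLpNorm (H n - fun _ => 0) 1 μ = ENNReal.ofReal (‖F (k n) - G‖ ^ 2) := by
    intro n
    rw [Lp.norm_sq_eq_integral, integral_prod _ (Lp.integrable_norm_sq (F (k n) - G)),
      eLpNorm_one_eq_lintegral_enorm]
    change ∫⁻ x, ‖H n x - 0‖ₑ ∂μ = ENNReal.ofReal (∫ x, H n x ∂μ)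
    simp only [sub_zero]
    rw [← ofReal_integral_norm_eq_lintegral_enorm (hHi n)]
    simp only [Real.norm_of_nonneg (hH0 n _)]
  have hHm : TendstoInMeasure μ H atTop fun _ => 0 := by
    refine tendstoInMeasure_of_tendsto_eLpNorm one_ne_zero (fun n => (hHi n).1)
      aestronglyMeasurable_const ?_
    simp only [hHn]
    have h1 : Tendsto (fun n => ‖F (k n) - G‖ ^ 2) atTop (𝓝 0) := by
      have := ((tendsto_iff_norm_sub_tendsto_zero.1 hF).comp hk.tendsto_atTop).pow 2
      simpa using this
    simpa using (ENNReal.tendsto_ofReal h1)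
  obtain ⟨l, hl, hl'⟩ := hHm.exists_seq_tendsto_ae
  have hG : ∀ᵐ x ∂μ, MemLp (fun y => G (x, y)) 2 ν := by
    filter_upwards [(Lp.integrable_norm_sq G).prod_right_ae,
      (Lp.aestronglyMeasurable G).prodMk_left] with x h1 h2
    exact (memLp_two_iff_integrable_sq_norm h2).2 h1
  filter_upwards [hk', hl', hG, ae_all_iff.2 fun n => h n,
    ae_all_iff.2 fun n => Measure.ae_ae_of_ae_prod (Lp.coeFn_sub (F (k n)) G)] with x h1 h2 h3 h4 h5
  have h6 : ∀ n, ‖f (k (l n)) x - h3.toLp _‖ ^ 2 = H (l n) x := by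
    intro n
    rw [Lp.norm_sq_eq_integral]
    refine integral_congr_ae ?_
    filter_upwards [h4 (k (l n)), h5 (l n), h3.coeFn_toLp, Lp.coeFn_sub (f (k (l n)) x) (h3.toLp _)]
      with y e1 e2 e3 e4
    rw [e4, e2, Pi.sub_apply, Pi.sub_apply, e1, e3]
  have h7 : Tendsto (fun n => ‖f (k (l n)) x - h3.toLp _‖) atTop (𝓝 0) := by
    have := h2.sqrt
    simp only [← h6, Real.sqrt_sq (norm_nonneg _), Real.sqrt_zero] at this
    exact this
  have h8 := tendsto_nhds_unique (tendsto_iff_norm_sub_tendsto_zero.2 h7)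
    (h1.comp hl.tendsto_atTop)
  filter_upwards [h3.coeFn_toLp] with y hy
  rw [← h8, hy]

/-- Explicit for indicators, additive, and closed under limits by the isometry and completeness. -/
theorem exists_isUncurry [CompleteSpace E] (f : Lp (Lp E 2 ν) 2 μ) : ∃ F, IsUncurry f F := by
  refine Lp.induction (by simp) (motive := fun f : Lp (Lp E 2 ν) 2 μ => ∃ F, IsUncurry f F)
    ?_ ?_ ?_ f
  · intro c s hs hμs
    exact exists_isUncurry_indicator c hs hμs
  · rintro f g hf hg - ⟨F, hF⟩ ⟨G, hG⟩
    exact ⟨F + G, hF.add hG⟩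
  · refine IsSeqClosed.isClosed fun f g hf hg => ?_
    choose F hF using hf
    have hc : CauchySeq F := by
      have := hg.cauchySeq
      rw [Metric.cauchySeq_iff] at this ⊢
      intro r hr
      obtain ⟨N, hN⟩ := this r hr
      refine ⟨N, fun m hm n hn => ?_⟩
      have := hN m hm n hn
      rw [dist_eq_norm] at this ⊢
      rwa [((hF m).sub (hF n)).norm_eq]
    obtain ⟨G, hG⟩ := cauchySeq_tendsto_of_complete hc
    exact ⟨G, isUncurry_of_tendsto hF hg hG⟩

end Uncurry

/-! ### Periodic extensions of `L²` functions on the torus -/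

/-- Allows almost everywhere identities on the torus to be pulled back to all of `ℝ³`; the local
comparison of measures is summed over balls. -/
lemma quasiMeasurePreserving_torusProj :
    Measure.QuasiMeasurePreserving torusProj volume τ := by
  refine ⟨continuous_torusProj.measurable, Measure.AbsolutelyContinuous.mk fun A hA h0 => ?_⟩
  rw [Measure.map_apply continuous_torusProj.measurable hA]
  have hcov : torusProj ⁻¹' A ⊆ ⋃ n : ℕ, torusProj ⁻¹' A ∩ Metric.closedBall (0 : E3) n := by
    intro x hx
    obtain ⟨n, hn⟩ := exists_nat_ge ‖x‖
    exact mem_iUnion.2 ⟨n, hx, by simpa using hn⟩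
  refine measure_mono_null hcov (measure_iUnion_null fun n => ?_)
  obtain ⟨c, -, hc⟩ := exists_map_torusProj_le (isCompact_closedBall (0 : E3) n)
  have h1 := hc A
  rw [Measure.map_apply continuous_torusProj.measurable hA,
    Measure.restrict_apply (continuous_torusProj.measurable hA)] at h1
  simpa [h0] using h1

lemma memL2loc_torus {F : Type} [NormedAddCommGroup F] (u : Lp F 2 τ) :
    MemL2loc (fun x => u (torusProj x)) univ := by
  intro K hK _
  obtain ⟨c, hc, h⟩ := exists_map_torusProj_le hK
  have h1 : MemLp u 2 ((volume.restrict K).map torusProj) := (Lp.memLp u).of_measure_le_smul hc h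
  exact h1.comp_of_map continuous_torusProj.aemeasurable

/-- The constant is uniform in `u`, which gives continuity of `torusPairing`. Passing from the `L¹`
to the `L²` norm costs nothing since `τ` is a probability measure. -/
lemma integral_norm_torus_le {F : Type} [NormedAddCommGroup F] {K : Set E3} (hK : IsCompact K) :
    ∃ C : ℝ, 0 ≤ C ∧ ∀ u : Lp F 2 τ, ∫ x in K, ‖u (torusProj x)‖ ≤ C * ‖u‖ := by
  obtain ⟨c, hc, h⟩ := exists_map_torusProj_le hK
  refine ⟨c.toReal, ENNReal.toReal_nonneg, fun u => ?_⟩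
  have hi : Integrable (fun t => ‖u t‖) τ := ((Lp.memLp u).integrable (by simp)).norm
  have h1 : ∫ x in K, ‖u (torusProj x)‖ = ∫ t, ‖u t‖ ∂((volume.restrict K).map torusProj) := by
    rw [integral_map continuous_torusProj.aemeasurable]
    exact (((Lp.memLp u).of_measure_le_smul hc h).1).norm
  rw [h1]
  calc ∫ t, ‖u t‖ ∂((volume.restrict K).map torusProj) ≤ ∫ t, ‖u t‖ ∂(c • τ) :=
        integral_mono_measure h (ae_of_all _ fun t => norm_nonneg _) (hi.smul_measure hc)
    _ = c.toReal * ∫ t, ‖u t‖ ∂τ := by rw [integral_smul_measure, smul_eq_mul]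
    _ ≤ c.toReal * ‖u‖ := by
        gcongr
        rw [integral_norm_eq_lintegral_enorm (Lp.aestronglyMeasurable u), ← eLpNorm_one_eq_lintegral_enorm,
          Lp.norm_def]
        exact ENNReal.toReal_mono (Lp.eLpNorm_ne_top u)
          (eLpNorm_le_eLpNorm_of_exponent_le (by norm_num) (Lp.aestronglyMeasurable u))

lemma integrable_torus_mul (u : Lp ℂ 2 τ) {ψ : E3 → ℂ} (hψ : Continuous ψ)
    (hc : HasCompactSupport ψ) : Integrable (fun x => u (torusProj x) * ψ x) := by
  have h1 := memL2loc_torus u (tsupport ψ) hc (subset_univ _)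
  have h2 : MemLp ψ 2 (volume.restrict (tsupport ψ)) :=
    (hψ.memLp_of_hasCompactSupport hc).restrict _
  have h3 : IntegrableOn (fun x => u (torusProj x) * ψ x) (tsupport ψ) volume := h1.integrable_mul h2
  refine (integrableOn_iff_integrable_of_support_subset ?_).1 h3
  intro x hx
  by_contra hx'
  exact hx (by simp [image_eq_zero_of_notMem_tsupport hx'])

/-- Pairing of the periodic extension with a compactly supported continuous function. -/
def torusPairing (ψ : E3 → ℂ) (hψ : Continuous ψ) (hc : HasCompactSupport ψ) :
    Lp ℂ 2 τ →L[ℂ] ℂ :=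
  LinearMap.mkContinuousOfExistsBound
    { toFun := fun u => ∫ x, u (torusProj x) * ψ x
      map_add' := fun u v => by
        rw [← integral_add (integrable_torus_mul u hψ hc) (integrable_torus_mul v hψ hc)]
        refine integral_congr_ae ?_
        filter_upwards [quasiMeasurePreserving_torusProj.ae (Lp.coeFn_add u v)] with x hx
        rw [hx, Pi.add_apply, add_mul]
      map_smul' := fun a u => by
        rw [RingHom.id_apply, ← integral_smul]
        refine integral_congr_ae ?_
        filter_upwards [quasiMeasurePreserving_torusProj.ae (Lp.coeFn_smul a u)] with x hx
        rw [hx, Pi.smul_apply, smul_mul_assoc] }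
    (by
      obtain ⟨C, hC, h⟩ := integral_norm_torus_le (F := ℂ) hc
      obtain ⟨B, hB⟩ := hc.exists_bound_of_continuous hψ
      refine ⟨B * C, fun u => ?_⟩
      have hB0 : 0 ≤ B := (norm_nonneg _).trans (hB 0)
      have e : ∫ x, u (torusProj x) * ψ x = ∫ x in tsupport ψ, u (torusProj x) * ψ x :=
        (setIntegral_eq_integral_of_forall_compl_eq_zero fun x hx => by
          rw [image_eq_zero_of_notMem_tsupport hx, mul_zero]).symm
      have hi : Integrable (fun x => ‖u (torusProj x)‖) (volume.restrict (tsupport ψ)) := by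
        have : IsFiniteMeasure (volume.restrict (tsupport ψ)) :=
          ⟨by simpa using hc.isCompact.measure_lt_top⟩
        exact ((memL2loc_torus u _ hc (subset_univ _)).integrable (by norm_num)).norm
      simp only [LinearMap.coe_mk, AddHom.coe_mk]
      rw [e, mul_assoc]
      calc ‖∫ x in tsupport ψ, u (torusProj x) * ψ x‖
          ≤ ∫ x in tsupport ψ, B * ‖u (torusProj x)‖ := by
            refine norm_integral_le_of_norm_le (hi.const_mul B) (ae_of_all _ fun x => ?_)
            rw [norm_mul, mul_comm]
            exact mul_le_mul_of_nonneg_right (hB x) (norm_nonneg _)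
        _ = B * ∫ x in tsupport ψ, ‖u (torusProj x)‖ := integral_const_mul _ _
        _ ≤ B * (C * ‖u‖) := mul_le_mul_of_nonneg_left (h u) hB0)

lemma torusPairing_apply (ψ : E3 → ℂ) (hψ : Continuous ψ) (hc : HasCompactSupport ψ)
    (u : Lp ℂ 2 τ) : torusPairing ψ hψ hc u = ∫ x, u (torusProj x) * ψ x := rfl

/-! ### Fourier multipliers -/

/-- The Hilbert basis of exponential monomials. -/
def fourierBasis : HilbertBasis (Fin 3 → ℤ) ℂ (Lp ℂ 2 τ) := UnitAddTorus.mFourierBasis (d := Fin 3)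

lemma coeFn_fourierBasis (k : Fin 3 → ℤ) : fourierBasis k =ᵐ[τ] UnitAddTorus.mFourier k := by
  have : fourierBasis k = (UnitAddTorus.mFourierLp (d := Fin 3) 2 k : Lp ℂ 2 τ) :=
    congrFun UnitAddTorus.coe_mFourierBasis k
  rw [this]
  exact UnitAddTorus.coeFn_mFourierLp 2 k

/-- Multiplication by a bounded sequence on `ℓ²`. -/
def diagonal {ι : Type} (m : ι → ℂ) (hm : ∀ k, ‖m k‖ ≤ 1) :
    lp (fun _ : ι => ℂ) 2 →L[ℂ] lp (fun _ : ι => ℂ) 2 :=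
  have hle : ∀ (a : lp (fun _ : ι => ℂ) 2) (k : ι), ‖m k * a k‖ ≤ ‖a k‖ := fun a k => by
    rw [norm_mul]
    exact mul_le_of_le_one_left (norm_nonneg _) (hm k)
  LinearMap.mkContinuous
    { toFun := fun a => ⟨fun k => m k * a k, (lp.memℓp a).mono' (hle a)⟩
      map_add' := fun a b => by
        ext k
        exact mul_add _ _ _
      map_smul' := fun c a => by
        ext k
        exact mul_left_comm _ _ _ } 1
    (fun a => by
      rw [one_mul]
      exact lp.norm_mono (by simp) (hle a))

/-- The Fourier multiplier with symbol `m`. -/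
def multiplier (m : (Fin 3 → ℤ) → ℂ) (hm : ∀ k, ‖m k‖ ≤ 1) : Lp ℂ 2 τ →L[ℂ] Lp ℂ 2 τ :=
  (fourierBasis.repr.symm.toContinuousLinearEquiv.toContinuousLinearMap).comp
    ((diagonal m hm).comp fourierBasis.repr.toContinuousLinearEquiv.toContinuousLinearMap)

lemma repr_multiplier (m : (Fin 3 → ℤ) → ℂ) (hm : ∀ k, ‖m k‖ ≤ 1) (u : Lp ℂ 2 τ)
    (k : Fin 3 → ℤ) :
    fourierBasis.repr (multiplier m hm u) k = m k * fourierBasis.repr u k := by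
  simp only [multiplier, ContinuousLinearMap.comp_apply]
  erw [LinearIsometryEquiv.apply_symm_apply]
  rfl

lemma multiplier_basis (m : (Fin 3 → ℤ) → ℂ) (hm : ∀ k, ‖m k‖ ≤ 1) (k : Fin 3 → ℤ) :
    multiplier m hm (fourierBasis k) = m k • fourierBasis k := by
  classical
  apply fourierBasis.repr.injective
  ext l
  rw [repr_multiplier, map_smul, HilbertBasis.repr_self]
  by_cases h : l = k
  · subst h
    simp
  · simp [h]

lemma ext_fourierBasis {G : Type} [NormedAddCommGroup G] [NormedSpace ℂ G]
    {S T : Lp ℂ 2 τ →L[ℂ] G} (h : ∀ k, S (fourierBasis k) = T (fourierBasis k)) : S = T := by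
  refine ContinuousLinearMap.ext_on (s := range fourierBasis) ?_ ?_
  · have := fourierBasis.dense_span
    rw [← Submodule.dense_iff_topologicalClosure_eq_top] at this
    exact this
  · rintro _ ⟨k, rfl⟩
    exact h k

lemma ext_fourierCoeff {u v : Lp ℂ 2 τ} (h : ∀ k, fourierBasis.repr u k = fourierBasis.repr v k) :
    u = v :=
  fourierBasis.repr.injective (lp.ext (funext h))

/-- The squared length of a frequency. -/
def lenSq (k : Fin 3 → ℤ) : ℝ := (k 0 : ℝ) ^ 2 + (k 1 : ℝ) ^ 2 + (k 2 : ℝ) ^ 2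

lemma lenSq_pos {k : Fin 3 → ℤ} (hk : k ≠ 0) : 0 < lenSq k := by
  by_contra h
  apply hk
  have h0 := sq_nonneg (k 0 : ℝ)
  have h1 := sq_nonneg (k 1 : ℝ)
  have h2 := sq_nonneg (k 2 : ℝ)
  unfold lenSq at h
  have e0 : (k 0 : ℝ) = 0 := pow_eq_zero_iff two_ne_zero |>.1 (by linarith)
  have e1 : (k 1 : ℝ) = 0 := pow_eq_zero_iff two_ne_zero |>.1 (by linarith)
  have e2 : (k 2 : ℝ) = 0 := pow_eq_zero_iff two_ne_zero |>.1 (by linarith)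
  funext i
  fin_cases i
  · exact_mod_cast e0
  · exact_mod_cast e1
  · exact_mod_cast e2

lemma sq_le_lenSq (k : Fin 3 → ℤ) (i : Fin 3) : (k i : ℝ) ^ 2 ≤ lenSq k := by
  have h0 := sq_nonneg (k 0 : ℝ)
  have h1 := sq_nonneg (k 1 : ℝ)
  have h2 := sq_nonneg (k 2 : ℝ)
  unfold lenSq
  fin_cases i <;> simp <;> linarith

/-- The symbol of `∂ᵢ Δ⁻¹`. -/
def symS (i : Fin 3) (k : Fin 3 → ℤ) : ℂ := -Complex.I * ((k i / (2 * Real.pi * lenSq k) : ℝ) : ℂ)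

/-- The symbol of `∂ᵢ ∂ⱼ Δ⁻¹`. -/
def symR (i j : Fin 3) (k : Fin 3 → ℤ) : ℂ := ((k i * k j / lenSq k : ℝ) : ℂ)

/-- Frequencies are integers, so `|k i| ≤ (k i)² ≤ lenSq k`. At `k = 0` division by zero makes the
symbol `0`: the inverse Laplacian kills constants. -/
lemma norm_symS_le (i : Fin 3) (k : Fin 3 → ℤ) : ‖symS i k‖ ≤ 1 := by
  rw [symS, norm_mul, norm_neg, Complex.norm_I, one_mul, Complex.norm_real, Real.norm_eq_abs,
    abs_div]
  by_cases hk : k = 0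
  · simp [hk]
  · have hp := lenSq_pos hk
    have h1 : |(k i : ℝ)| ≤ (k i : ℝ) ^ 2 := by
      have : |k i| ≤ (k i) ^ 2 := by
        rw [← sq_abs]
        rcases (abs_nonneg (k i)).eq_or_lt with h | h
        · rw [← h]; simp
        · nlinarith
      exact_mod_cast this
    have h2 := sq_le_lenSq k i
    have h3 := Real.pi_gt_three
    rw [abs_of_pos (by positivity : (0 : ℝ) < 2 * Real.pi * lenSq k), div_le_one (by positivity)]
    nlinarith

lemma norm_symR_le (i j : Fin 3) (k : Fin 3 → ℤ) : ‖symR i j k‖ ≤ 1 := by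
  rw [symR, Complex.norm_real, Real.norm_eq_abs, abs_div]
  by_cases hk : k = 0
  · simp [hk]
  · have hp := lenSq_pos hk
    rw [abs_of_pos hp, div_le_one hp, abs_mul]
    have h1 := sq_le_lenSq k i
    have h2 := sq_le_lenSq k j
    rw [← sq_abs] at h1 h2
    nlinarith [sq_nonneg (|(k i : ℝ)| - |(k j : ℝ)|)]

lemma symS_mul (i j : Fin 3) (k : Fin 3 → ℤ) :
    2 * Real.pi * Complex.I * k j * symS i k = symR i j k := by
  simp only [symS, symR]
  push_cast
  by_cases hk : k = 0
  · simp [hk]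
  · have hp : (lenSq k : ℂ) ≠ 0 := by exact_mod_cast (lenSq_pos hk).ne'
    have hpi : (Real.pi : ℂ) ≠ 0 := by exact_mod_cast Real.pi_ne_zero
    field_simp
    rw [Complex.I_sq]
    ring

lemma symR_comm (i j : Fin 3) : symR i j = symR j i := by
  funext k
  simp only [symR, mul_comm]

lemma hasFDerivAt_mFourier (k : Fin 3 → ℤ) (j : Fin 3) (x : E3) :
    DifferentiableAt ℝ (fun x => UnitAddTorus.mFourier k (torusProj x)) x ∧
    fderiv ℝ (fun x => UnitAddTorus.mFourier k (torusProj x)) x (e j) =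
      2 * Real.pi * Complex.I * k j * UnitAddTorus.mFourier k (torusProj x) := by
  simp only [mFourier_torusProj]
  let l : E3 →L[ℝ] ℝ := (k 0 : ℝ) • EuclideanSpace.proj 0 + (k 1 : ℝ) • EuclideanSpace.proj 1 +
    (k 2 : ℝ) • EuclideanSpace.proj 2
  have h : HasFDerivAt (fun x : E3 =>
      Complex.exp (2 * Real.pi * Complex.I * (k 0 * x 0 + k 1 * x 1 + k 2 * x 2 : ℝ)))
      (Complex.exp (2 * Real.pi * Complex.I * (l x : ℝ)) •
        ((2 * Real.pi * Complex.I) • (Complex.ofRealCLM.comp l))) x :=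
    (((Complex.ofRealCLM.comp l).hasFDerivAt).const_mul (2 * Real.pi * Complex.I)).cexp
  refine ⟨h.differentiableAt, ?_⟩
  rw [h.fderiv]
  have : l (e j) = k j := by
    fin_cases j <;> simp [l, e]
  simp only [smul_apply, ContinuousLinearMap.comp_apply, this,
    Complex.ofRealCLM_apply, smul_eq_mul]
  simp only [l]
  simp
  ring

/-- Integration by parts against exponential monomials. -/
lemma integral_mFourier_mul_pd (k : Fin 3 → ℤ) (j : Fin 3) {φ : E3 → ℝ} (hφ : IsTest univ φ) :
    ∫ x, UnitAddTorus.mFourier k (torusProj x) * (pd j φ x : ℂ) =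
      -(2 * Real.pi * Complex.I * k j) * ∫ x, UnitAddTorus.mFourier k (torusProj x) * (φ x : ℂ) := by
  have hd : Differentiable ℝ φ := hφ.1.differentiable (by simp)
  have hg : ∀ x, HasFDerivAt (fun x => (φ x : ℂ)) (Complex.ofRealCLM.comp (fderiv ℝ φ x)) x :=
    fun x => (Complex.ofRealCLM.hasFDerivAt).comp x (hd x).hasFDerivAt
  have hpd : ∀ x, fderiv ℝ (fun x => (φ x : ℂ)) x (e j) = (pd j φ x : ℂ) := fun x => by
    rw [(hg x).fderiv]; rfl
  have hcm : Continuous fun x => UnitAddTorus.mFourier k (torusProj x) :=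
    (UnitAddTorus.mFourier k).continuous.comp continuous_torusProj
  have hcφ : HasCompactSupport fun x => (φ x : ℂ) := hφ.2.1.comp_left Complex.ofReal_zero
  have hcd : HasCompactSupport fun x => (pd j φ x : ℂ) :=
    HasCompactSupport.comp_left (g := ((↑) : ℝ → ℂ))
      (hφ.2.1.of_isClosed_subset (isClosed_tsupport _) (tsupport_pd_subset j φ)) Complex.ofReal_zero
  have hcφ' : Continuous fun x => (φ x : ℂ) := Complex.continuous_ofReal.comp hφ.1.continuous
  have hcd' : Continuous fun x => (pd j φ x : ℂ) :=
    Complex.continuous_ofReal.comp (continuous_pd hφ.1 j)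
  have h := integral_mul_fderiv_eq_neg_fderiv_mul_of_integrable (μ := (volume : Measure E3))
    (f := fun x => UnitAddTorus.mFourier k (torusProj x)) (g := fun x => (φ x : ℂ)) (v := e j)
    ?_ ?_ ?_ (fun x _ => (hasFDerivAt_mFourier k j x).1) (fun x _ => (hg x).differentiableAt)
  · simp only [hpd, (hasFDerivAt_mFourier k j _).2, mul_assoc] at h
    simp only [mul_assoc, integral_const_mul] at h ⊢
    rw [h]
    ring
  · simp only [(hasFDerivAt_mFourier k j _).2]
    exact (((continuous_const.mul hcm).mul hcφ').integrable_of_hasCompactSupport hcφ.mul_left)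
  · simp only [hpd]
    exact (hcm.mul hcd').integrable_of_hasCompactSupport hcd.mul_left
  · exact (hcm.mul hcφ').integrable_of_hasCompactSupport hcφ.mul_left

/-- `∂ⱼ (∂ᵢ Δ⁻¹) = ∂ᵢ ∂ⱼ Δ⁻¹` in the sense of distributions. -/
lemma integral_multiplier_mul_pd (i j : Fin 3) (u : Lp ℂ 2 τ) {φ : E3 → ℝ} (hφ : IsTest univ φ) :
    ∫ x, multiplier (symS i) (norm_symS_le i) u (torusProj x) * (pd j φ x : ℂ) =
      -∫ x, multiplier (symR i j) (norm_symR_le i j) u (torusProj x) * (φ x : ℂ) := by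
  have hcφ : HasCompactSupport fun x => (φ x : ℂ) := hφ.2.1.comp_left Complex.ofReal_zero
  have hcd : HasCompactSupport fun x => (pd j φ x : ℂ) :=
    HasCompactSupport.comp_left (g := ((↑) : ℝ → ℂ))
      (hφ.2.1.of_isClosed_subset (isClosed_tsupport _) (tsupport_pd_subset j φ)) Complex.ofReal_zero
  have hcφ' : Continuous fun x => (φ x : ℂ) := Complex.continuous_ofReal.comp hφ.1.continuous
  have hcd' : Continuous fun x => (pd j φ x : ℂ) :=
    Complex.continuous_ofReal.comp (continuous_pd hφ.1 j)
  -- Both sides are continuous and linear in `u`, so it suffices to check exponentials, where this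
  -- is classical integration by parts together with `symS_mul`.
  have key : (torusPairing _ hcd' hcd).comp (multiplier (symS i) (norm_symS_le i)) =
      -(torusPairing _ hcφ' hcφ).comp (multiplier (symR i j) (norm_symR_le i j)) := by
    refine ext_fourierBasis fun k => ?_
    simp only [neg_apply, ContinuousLinearMap.comp_apply, multiplier_basis,
      map_smul, torusPairing_apply, smul_eq_mul]
    have hb := quasiMeasurePreserving_torusProj.ae (coeFn_fourierBasis k)
    have hb' : ∀ ψ : E3 → ℂ, ∫ x, fourierBasis k (torusProj x) * ψ x =
        ∫ x, UnitAddTorus.mFourier k (torusProj x) * ψ x := fun ψ =>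
      integral_congr_ae (hb.mono fun x hx => by simp only [hx])
    rw [hb', hb', integral_mFourier_mul_pd k j hφ, ← symS_mul]
    ring
  exact DFunLike.congr_fun key u

/-! ### Real Fourier multipliers -/

/-- Complexification. -/
def cx : Lp ℝ 2 τ →L[ℝ] Lp ℂ 2 τ := Complex.ofRealCLM.compLpL 2 τ

/-- The real part. -/
def rePart : Lp ℂ 2 τ →L[ℝ] Lp ℝ 2 τ := Complex.reCLM.compLpL 2 τ

lemma coeFn_cx (u : Lp ℝ 2 τ) : cx u =ᵐ[τ] fun t => (u t : ℂ) :=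
  ContinuousLinearMap.coeFn_compLpL _ _

lemma coeFn_rePart (u : Lp ℂ 2 τ) : rePart u =ᵐ[τ] fun t => (u t).re :=
  ContinuousLinearMap.coeFn_compLpL _ _

lemma rePart_cx (u : Lp ℝ 2 τ) : rePart (cx u) = u := by
  refine Lp.ext ?_
  filter_upwards [coeFn_rePart (cx u), coeFn_cx u] with t h1 h2
  rw [h1, h2, Complex.ofReal_re]

/-- The action of a Fourier multiplier on real functions, followed by the real part. -/
def realMultiplier (m : (Fin 3 → ℤ) → ℂ) (hm : ∀ k, ‖m k‖ ≤ 1) : Lp ℝ 2 τ →L[ℝ] Lp ℝ 2 τ :=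
  rePart.comp (((multiplier m hm).restrictScalars ℝ).comp cx)

lemma realMultiplier_apply (m : (Fin 3 → ℤ) → ℂ) (hm : ∀ k, ‖m k‖ ≤ 1) (u : Lp ℝ 2 τ) :
    realMultiplier m hm u = rePart (multiplier m hm (cx u)) := rfl

/-- The operator `∂ᵢ Δ⁻¹`. -/
def opS (i : Fin 3) : Lp ℝ 2 τ →L[ℝ] Lp ℝ 2 τ := realMultiplier (symS i) (norm_symS_le i)

/-- The operator `∂ᵢ ∂ⱼ Δ⁻¹`. -/
def opR (i j : Fin 3) : Lp ℝ 2 τ →L[ℝ] Lp ℝ 2 τ := realMultiplier (symR i j) (norm_symR_le i j)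

lemma opR_comm (i j : Fin 3) : opR i j = opR j i := by
  simp only [opR, symR_comm i j]

/-- `b` is the weak derivative `∂ⱼ a` of functions on the torus. -/
def WeakPd (j : Fin 3) (a b : Lp ℝ 2 τ) : Prop :=
  ∀ φ : E3 → ℝ, IsTest univ φ →
    ∫ x, a (torusProj x) * pd j φ x = -∫ x, b (torusProj x) * φ x

lemma integrable_torus_mul_pd (a : Lp ℝ 2 τ) {φ : E3 → ℝ} (hφ : IsTest univ φ) (j : Fin 3) :
    Integrable fun x => a (torusProj x) * pd j φ x := by
  simpa using hφ.integrable_mul_pd (memL2loc_torus a) j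

lemma integrable_torus_mul_test (a : Lp ℝ 2 τ) {φ : E3 → ℝ} (hφ : IsTest univ φ) :
    Integrable fun x => a (torusProj x) * φ x := by
  simpa using hφ.integrable_mul (memL2loc_torus a)

lemma WeakPd.add {j : Fin 3} {a b a' b' : Lp ℝ 2 τ} (h : WeakPd j a b) (h' : WeakPd j a' b') :
    WeakPd j (a + a') (b + b') := by
  intro φ hφ
  have e1 : ∫ x, (a + a') (torusProj x) * pd j φ x =
      ∫ x, (a (torusProj x) * pd j φ x + a' (torusProj x) * pd j φ x) := by
    refine integral_congr_ae ?_
    filter_upwards [quasiMeasurePreserving_torusProj.ae (Lp.coeFn_add a a')] with x hx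
    rw [hx, Pi.add_apply, add_mul]
  have e2 : ∫ x, (b + b') (torusProj x) * φ x =
      ∫ x, (b (torusProj x) * φ x + b' (torusProj x) * φ x) := by
    refine integral_congr_ae ?_
    filter_upwards [quasiMeasurePreserving_torusProj.ae (Lp.coeFn_add b b')] with x hx
    rw [hx, Pi.add_apply, add_mul]
  rw [e1, e2, integral_add (integrable_torus_mul_pd a hφ j) (integrable_torus_mul_pd a' hφ j),
    integral_add (integrable_torus_mul_test b hφ) (integrable_torus_mul_test b' hφ), h φ hφ, h' φ hφ]
  ring

lemma WeakPd.neg {j : Fin 3} {a b : Lp ℝ 2 τ} (h : WeakPd j a b) : WeakPd j (-a) (-b) := by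
  intro φ hφ
  have e1 : ∫ x, (-a) (torusProj x) * pd j φ x = ∫ x, -(a (torusProj x) * pd j φ x) := by
    refine integral_congr_ae ?_
    filter_upwards [quasiMeasurePreserving_torusProj.ae (Lp.coeFn_neg a)] with x hx
    rw [hx, Pi.neg_apply, neg_mul]
  have e2 : ∫ x, (-b) (torusProj x) * φ x = ∫ x, -(b (torusProj x) * φ x) := by
    refine integral_congr_ae ?_
    filter_upwards [quasiMeasurePreserving_torusProj.ae (Lp.coeFn_neg b)] with x hx
    rw [hx, Pi.neg_apply, neg_mul]
  rw [e1, e2, integral_neg, integral_neg, h φ hφ]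

lemma WeakPd.sub {j : Fin 3} {a b a' b' : Lp ℝ 2 τ} (h : WeakPd j a b) (h' : WeakPd j a' b') :
    WeakPd j (a - a') (b - b') := by
  simpa only [sub_eq_add_neg] using h.add h'.neg

/-- Taking real parts commutes with integration against a real test function, so the complex
identity passes to the real operators without showing that the multipliers preserve real functions.
-/
lemma weakPd_opS (i j : Fin 3) (u : Lp ℝ 2 τ) : WeakPd j (opS i u) (opR i j u) := by
  have re_eq : ∀ (v : Lp ℂ 2 τ) {ψ : E3 → ℝ}, Continuous ψ → HasCompactSupport ψ →
      ∫ x, rePart v (torusProj x) * ψ x = (∫ x, v (torusProj x) * (ψ x : ℂ)).re := by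
    intro v ψ hψ hc
    have hi : Integrable fun x => v (torusProj x) * (ψ x : ℂ) :=
      integrable_torus_mul v (Complex.continuous_ofReal.comp hψ)
        (hc.comp_left (g := ((↑) : ℝ → ℂ)) Complex.ofReal_zero)
    rw [← Complex.reCLM_apply, ← Complex.reCLM.integral_comp_comm hi]
    refine integral_congr_ae ?_
    filter_upwards [quasiMeasurePreserving_torusProj.ae (coeFn_rePart v)] with x hx
    rw [hx, Complex.reCLM_apply, Complex.re_mul_ofReal]
  intro φ hφ
  have hcd : HasCompactSupport (pd j φ) :=
    hφ.2.1.of_isClosed_subset (isClosed_tsupport _) (tsupport_pd_subset j φ)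
  rw [opS, opR, realMultiplier_apply, realMultiplier_apply, re_eq _ (continuous_pd hφ.1 j) hcd,
    re_eq _ hφ.1.continuous hφ.2.1, integral_multiplier_mul_pd i j (cx u) hφ, Complex.neg_re]

/-! ### Vector fields on the torus -/

/-- The `i`-th component of a vector field. -/
def coord (i : Fin 3) : Lp E3 2 τ →L[ℝ] Lp ℝ 2 τ :=
  (EuclideanSpace.proj (𝕜 := ℝ) i : E3 →L[ℝ] ℝ).compLpL 2 τ

lemma coeFn_coord (i : Fin 3) (u : Lp E3 2 τ) : coord i u =ᵐ[τ] fun t => u t i :=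
  ContinuousLinearMap.coeFn_compLpL _ _

/-- The vector field with components `T 0`, `T 1`, `T 2`. -/
def assemble {G : Type} [NormedAddCommGroup G] [NormedSpace ℝ G] (T : Fin 3 → G →L[ℝ] Lp ℝ 2 τ) :
    G →L[ℝ] Lp E3 2 τ :=
  ∑ i, ((ContinuousLinearMap.toSpanSingleton ℝ (e i)).compLpL 2 τ).comp (T i)

lemma Lp_ext_coord {u v : Lp E3 2 τ} (h : ∀ i, coord i u = coord i v) : u = v := by
  refine Lp.ext ?_
  have h' : ∀ i, ∀ᵐ t ∂τ, u t i = v t i := fun i => by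
    filter_upwards [coeFn_coord i u, coeFn_coord i v] with t h1 h2
    rw [← h1, ← h2, h i]
  filter_upwards [ae_all_iff.2 h'] with t ht
  ext i
  exact ht i

lemma coord_assemble {G : Type} [NormedAddCommGroup G] [NormedSpace ℝ G]
    (T : Fin 3 → G →L[ℝ] Lp ℝ 2 τ) (i : Fin 3) (g : G) : coord i (assemble T g) = T i g := by
  have key : ∀ (j : Fin 3) (v : Lp ℝ 2 τ),
      coord i ((ContinuousLinearMap.toSpanSingleton ℝ (e j)).compLpL 2 τ v) =
        if j = i then v else 0 := by
    intro j v
    refine Lp.ext ?_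
    filter_upwards [coeFn_coord i ((ContinuousLinearMap.toSpanSingleton ℝ (e j)).compLpL 2 τ v),
      (ContinuousLinearMap.toSpanSingleton ℝ (e j)).coeFn_compLpL (p := 2) v,
      Lp.coeFn_zero ℝ 2 τ] with t h1 h2 h3
    rw [h1, h2]
    by_cases h : j = i
    · subst h
      simp [e]
    · rw [if_neg h, h3]
      simp [e, Ne.symm h]
  simp only [assemble, sum_apply, ContinuousLinearMap.comp_apply, map_sum, key]
  simp

/-- The mean value of a vector field. -/
def mean : Lp E3 2 τ →L[ℝ] E3 :=
  LinearMap.mkContinuous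
    { toFun := fun u => ∫ t, u t ∂τ
      map_add' := fun u v => by
        rw [← integral_add ((Lp.memLp u).integrable (by simp)) ((Lp.memLp v).integrable (by simp))]
        exact integral_congr_ae (Lp.coeFn_add u v)
      map_smul' := fun a u => by
        rw [RingHom.id_apply, ← integral_smul]
        exact integral_congr_ae (Lp.coeFn_smul a u) } 1
    (fun u => by
      simp only [LinearMap.coe_mk, AddHom.coe_mk]
      rw [one_mul]
      refine (norm_integral_le_integral_norm _).trans ?_
      rw [integral_norm_eq_lintegral_enorm (Lp.aestronglyMeasurable u),
        ← eLpNorm_one_eq_lintegral_enorm, Lp.norm_def]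
      exact ENNReal.toReal_mono (Lp.eLpNorm_ne_top u)
        (eLpNorm_le_eLpNorm_of_exponent_le (by norm_num) (Lp.aestronglyMeasurable u)))

lemma mean_apply (u : Lp E3 2 τ) : mean u = ∫ t, u t ∂τ := rfl

lemma mean_apply_coord (u : Lp E3 2 τ) (i : Fin 3) : mean u i = ∫ t, coord i u t ∂τ := by
  rw [mean_apply]
  have h := (EuclideanSpace.proj (𝕜 := ℝ) i : E3 →L[ℝ] ℝ).integral_comp_comm
    ((Lp.memLp u).integrable (by simp) : Integrable u τ)
  refine h.symm.trans (integral_congr_ae ?_)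
  filter_upwards [coeFn_coord i u] with t ht
  rw [ht]
  rfl

/-! ### Potentials on the torus and their weak derivatives -/

/-- The scalar potential `div Δ⁻¹ u`. -/
def potential : Lp E3 2 τ →L[ℝ] Lp ℝ 2 τ := ∑ i, (opS i).comp (coord i)

/-- The gradient part `∇ div Δ⁻¹ u`. -/
def gradPart : Lp E3 2 τ →L[ℝ] Lp E3 2 τ := assemble fun j => ∑ i, (opR i j).comp (coord i)

/-- The vector potential `-curl Δ⁻¹ u`. -/
def vecPotential : Lp E3 2 τ →L[ℝ] Lp E3 2 τ :=
  assemble ![(opS 2).comp (coord 1) - (opS 1).comp (coord 2),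
    (opS 0).comp (coord 2) - (opS 2).comp (coord 0),
    (opS 1).comp (coord 0) - (opS 0).comp (coord 1)]

/-- The solenoidal part `-curl curl Δ⁻¹ u`. -/
def curlPart : Lp E3 2 τ →L[ℝ] Lp E3 2 τ :=
  assemble ![((opR 1 1).comp (coord 0) - (opR 0 1).comp (coord 1)) -
      ((opR 0 2).comp (coord 2) - (opR 2 2).comp (coord 0)),
    ((opR 2 2).comp (coord 1) - (opR 1 2).comp (coord 2)) -
      ((opR 1 0).comp (coord 0) - (opR 0 0).comp (coord 1)),
    ((opR 0 0).comp (coord 2) - (opR 2 0).comp (coord 0)) -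
      ((opR 2 1).comp (coord 1) - (opR 1 1).comp (coord 2))]

lemma coord_gradPart (j : Fin 3) (u : Lp E3 2 τ) :
    coord j (gradPart u) = ∑ i, opR i j (coord i u) := by
  simp [gradPart, coord_assemble]

lemma weakPd_potential (j : Fin 3) (u : Lp E3 2 τ) :
    WeakPd j (potential u) (coord j (gradPart u)) := by
  rw [coord_gradPart]
  simp only [potential, Fin.sum_univ_three]
  exact ((weakPd_opS _ _ _).add (weakPd_opS _ _ _)).add (weakPd_opS _ _ _)

/-- The weak gradient of the periodic extension. -/
lemma hasWeakGrad_potential (u : Lp E3 2 τ) :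
    HasWeakGrad univ (fun x => potential u (torusProj x)) (fun x => gradPart u (torusProj x)) := by
  intro φ hφ i
  rw [Measure.restrict_univ, weakPd_potential i u φ hφ]
  refine congrArg Neg.neg (integral_congr_ae ?_)
  filter_upwards [quasiMeasurePreserving_torusProj.ae (coeFn_coord i (gradPart u))] with x hx
  rw [hx]

lemma integral_sub_add_sub_add_sub {f₁ f₂ f₃ f₄ f₅ f₆ : E3 → ℝ} (h₁ : Integrable f₁)
    (h₂ : Integrable f₂) (h₃ : Integrable f₃) (h₄ : Integrable f₄) (h₅ : Integrable f₅)
    (h₆ : Integrable f₆) :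
    ∫ x, ((f₁ x - f₂ x) + (f₃ x - f₄ x)) + (f₅ x - f₆ x) =
      ((∫ x, f₁ x) - ∫ x, f₂ x) + ((∫ x, f₃ x) - ∫ x, f₄ x) + ((∫ x, f₅ x) - ∫ x, f₆ x) := by
  rw [← integral_sub h₁ h₂, ← integral_sub h₃ h₄, ← integral_sub h₅ h₆]
  exact (integral_add ((h₁.sub h₂).add (h₃.sub h₄)) (h₅.sub h₆)).trans
    (congrArg (· + _) (integral_add (h₁.sub h₂) (h₃.sub h₄)))

/-- Here `g j m` stands for `∂ⱼ A_m`. The curl is formally self-adjoint: the sign from integration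
by parts is absorbed by the antisymmetry of the cross product. -/
lemma hasWeakCurl_of_weakPd {A C : Lp E3 2 τ} {g : Fin 3 → Fin 3 → Lp ℝ 2 τ}
    (hA : ∀ j m, WeakPd j (coord m A) (g j m))
    (h0 : coord 0 C = g 1 2 - g 2 1) (h1 : coord 1 C = g 2 0 - g 0 2)
    (h2 : coord 2 C = g 0 1 - g 1 0) :
    HasWeakCurl univ (fun x => A (torusProj x)) (fun x => C (torusProj x)) := by
  intro φ hφ
  rw [Measure.restrict_univ]
  have hA' : ∀ m, ∀ᵐ x : E3, coord m A (torusProj x) = A (torusProj x) m := fun m =>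
    quasiMeasurePreserving_torusProj.ae (coeFn_coord m A)
  have hC' : ∀ (m : Fin 3) (a b : Lp ℝ 2 τ), coord m C = a - b →
      ∀ᵐ x : E3, C (torusProj x) m = a (torusProj x) - b (torusProj x) := by
    intro m a b h
    filter_upwards [quasiMeasurePreserving_torusProj.ae (coeFn_coord m C),
      quasiMeasurePreserving_torusProj.ae (Lp.coeFn_sub a b)] with x h1 h2
    rw [← h1, h, h2, Pi.sub_apply]
  have e1 : ∫ x, inner ℝ (A (torusProj x)) (curl φ x) = ∫ x,
      ((coord 0 A (torusProj x) * pd 1 (fun z => φ z 2) x -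
        coord 0 A (torusProj x) * pd 2 (fun z => φ z 1) x) +
      (coord 1 A (torusProj x) * pd 2 (fun z => φ z 0) x -
        coord 1 A (torusProj x) * pd 0 (fun z => φ z 2) x)) +
      (coord 2 A (torusProj x) * pd 0 (fun z => φ z 1) x -
        coord 2 A (torusProj x) * pd 1 (fun z => φ z 0) x) := by
    refine integral_congr_ae ?_
    filter_upwards [ae_all_iff.2 hA'] with x hx
    simp only [hx, PiLp.inner_apply, Fin.sum_univ_three, curl, RCLike.inner_apply, conj_trivial]
    simp
    ring
  have e2 : ∫ x, inner ℝ (C (torusProj x)) (φ x) = ∫ x,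
      ((g 1 2 (torusProj x) * φ x 0 - g 2 1 (torusProj x) * φ x 0) +
      (g 2 0 (torusProj x) * φ x 1 - g 0 2 (torusProj x) * φ x 1)) +
      (g 0 1 (torusProj x) * φ x 2 - g 1 0 (torusProj x) * φ x 2) := by
    refine integral_congr_ae ?_
    filter_upwards [hC' 0 _ _ h0, hC' 1 _ _ h1, hC' 2 _ _ h2] with x h0 h1 h2
    simp only [PiLp.inner_apply, Fin.sum_univ_three, RCLike.inner_apply, conj_trivial, h0, h1, h2]
    ring
  have I1 : ∀ (j m l : Fin 3),
      Integrable fun x => coord m A (torusProj x) * pd j (fun z => φ z l) x :=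
    fun j m l => integrable_torus_mul_pd _ (hφ.coord l) j
  have I2 : ∀ (j m l : Fin 3), Integrable fun x => g j m (torusProj x) * φ x l :=
    fun j m l => integrable_torus_mul_test _ (hφ.coord l)
  rw [e1, e2, integral_sub_add_sub_add_sub (I1 _ _ _) (I1 _ _ _) (I1 _ _ _) (I1 _ _ _) (I1 _ _ _)
    (I1 _ _ _), integral_sub_add_sub_add_sub (I2 _ _ _) (I2 _ _ _) (I2 _ _ _) (I2 _ _ _)
    (I2 _ _ _) (I2 _ _ _)]
  simp only [hA _ _ _ (hφ.coord _)]
  ring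

lemma hasWeakCurl_vecPotential (u : Lp E3 2 τ) :
    HasWeakCurl univ (fun x => vecPotential u (torusProj x))
      (fun x => curlPart u (torusProj x)) := by
  refine hasWeakCurl_of_weakPd (g := fun j =>
    ![opR 2 j (coord 1 u) - opR 1 j (coord 2 u), opR 0 j (coord 2 u) - opR 2 j (coord 0 u),
      opR 1 j (coord 0 u) - opR 0 j (coord 1 u)]) ?_ ?_ ?_ ?_
  · intro j m
    rw [vecPotential, coord_assemble]
    fin_cases m <;> exact (weakPd_opS _ _ _).sub (weakPd_opS _ _ _)
  all_goals
    rw [curlPart, coord_assemble]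
    rfl

/-! ### The Helmholtz decomposition -/

lemma repr_cx (u : Lp ℝ 2 τ) (k : Fin 3 → ℤ) :
    fourierBasis.repr (cx u) k = ∫ t, UnitAddTorus.mFourier (-k) t * (u t : ℂ) ∂τ := by
  have h : fourierBasis.repr (cx u) k = UnitAddTorus.mFourierCoeff (cx u) k :=
    UnitAddTorus.mFourierBasis_repr (cx u) k
  rw [h]
  refine integral_congr_ae ?_
  filter_upwards [coeFn_cx u] with t ht
  rw [ht, smul_eq_mul]

/-- Reduces identities between the real operators `opR` to identities between symbols. -/
lemma eq_of_repr_cx {v : Lp ℂ 2 τ} {u : Lp ℝ 2 τ}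
    (h : ∀ k, fourierBasis.repr v k = fourierBasis.repr (cx u) k) : rePart v = u := by
  rw [ext_fourierCoeff h, rePart_cx]

lemma repr_cx_const (a : ℝ) (k : Fin 3 → ℤ) :
    fourierBasis.repr (cx (Lp.const 2 τ a)) k = if k = 0 then (a : ℂ) else 0 := by
  rw [repr_cx]
  have : ∫ t, UnitAddTorus.mFourier (-k) t * ((Lp.const 2 τ a : Lp ℝ 2 τ) t : ℂ) ∂τ =
      ∫ t, UnitAddTorus.mFourier (-k) t * (a : ℂ) ∂τ := by
    refine integral_congr_ae ?_
    filter_upwards [Lp.coeFn_const 2 τ a] with t ht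
    rw [ht]
    rfl
  rw [this, integral_mul_const, integral_mFourier]
  simp

lemma repr_cx_zero (u : Lp ℝ 2 τ) : fourierBasis.repr (cx u) 0 = ((∫ t, u t ∂τ : ℝ) : ℂ) := by
  rw [repr_cx, ← integral_complex_ofReal]
  simp [UnitAddTorus.mFourier_zero]

/-- The symbols `(k i)² / lenSq k` sum to `1` for `k ≠ 0` and to `0` at `k = 0`, where the
coefficient is the mean. -/
lemma sum_opR_self (u : Lp ℝ 2 τ) :
    opR 0 0 u + opR 1 1 u + opR 2 2 u = u - Lp.const 2 τ (∫ t, u t ∂τ) := by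
  simp only [opR, realMultiplier_apply, ← map_add]
  refine eq_of_repr_cx fun k => ?_
  simp only [map_add, map_sub, lp.coeFn_add, lp.coeFn_sub, Pi.add_apply, Pi.sub_apply,
    repr_multiplier, repr_cx_const]
  by_cases hk : k = 0
  · subst hk
    simp [symR, repr_cx_zero]
  · rw [if_neg hk, sub_zero, ← add_mul, ← add_mul]
    have : symR 0 0 k + symR 1 1 k + symR 2 2 k = 1 := by
      simp only [symR]
      have := lenSq_pos hk
      norm_cast
      rw [← add_div, ← add_div, div_eq_one_iff_eq this.ne', lenSq]
      push_cast
      ring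
    rw [this, one_mul]

lemma coord_const (a : E3) (i : Fin 3) : coord i (Lp.const 2 τ a) = Lp.const 2 τ (a i) := by
  refine Lp.ext ?_
  filter_upwards [coeFn_coord i (Lp.const 2 τ a), Lp.coeFn_const 2 τ a, Lp.coeFn_const 2 τ (a i)]
    with t h1 h2 h3
  rw [h1, h2, h3]
  rfl

/-- The Helmholtz decomposition of a periodic vector field. -/
lemma helmholtz (u : Lp E3 2 τ) : u = Lp.const 2 τ (mean u) + gradPart u + curlPart u := by
  refine Lp_ext_coord fun i => ?_
  -- This recovers the `i`-th component from its mean and the three diagonal operators applied to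
  -- it. The off-diagonal terms of the gradient and solenoidal parts cancel by the symmetry
  -- `opR_comm`, leaving exactly this sum.
  have h := sum_opR_self (coord i u)
  rw [← mean_apply_coord, ← coord_const] at h
  rw [map_add, map_add, coord_gradPart, curlPart, coord_assemble, Fin.sum_univ_three]
  rw [eq_sub_iff_add_eq] at h
  nth_rewrite 1 [← h]
  have c01 := opR_comm 0 1
  have c02 := opR_comm 0 2
  have c12 := opR_comm 1 2
  fin_cases i <;> simp [c01, c02, c12] <;> abel

/-- Fourier criterion for the vanishing of the gradient part. -/
lemma gradPart_eq_zero {u : Lp E3 2 τ}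
    (h : ∀ k : Fin 3 → ℤ, ∑ i, (k i : ℂ) * fourierBasis.repr (cx (coord i u)) k = 0) :
    gradPart u = 0 := by
  refine Lp_ext_coord fun j => ?_
  rw [coord_gradPart, map_zero, Fin.sum_univ_three]
  simp only [opR, realMultiplier_apply, ← map_add]
  refine eq_of_repr_cx fun k => ?_
  have hk := h k
  rw [Fin.sum_univ_three] at hk
  simp only [map_add, map_zero, lp.coeFn_add, lp.coeFn_zero, Pi.add_apply, Pi.zero_apply,
    repr_multiplier, symR]
  push_cast
  linear_combination (k j / lenSq k : ℂ) * hk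

/-- Fourier criterion for the vanishing of the solenoidal part. -/
lemma curlPart_eq_zero {u : Lp E3 2 τ}
    (h : ∀ (k : Fin 3 → ℤ) (i j : Fin 3), (k i : ℂ) * fourierBasis.repr (cx (coord j u)) k =
      k j * fourierBasis.repr (cx (coord i u)) k) :
    curlPart u = 0 := by
  -- By `helmholtz` it is enough that the gradient part already exhausts `u` minus its mean. On
  -- coefficients, `h` turns `∑ kᵢ kⱼ ûᵢ` into `∑ kᵢ² ûⱼ`, that is `lenSq k` times `ûⱼ`.
  have hg : gradPart u = u - Lp.const 2 τ (mean u) := by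
    refine Lp_ext_coord fun j => ?_
    rw [coord_gradPart, Fin.sum_univ_three, map_sub, coord_const]
    simp only [opR, realMultiplier_apply, ← map_add]
    refine eq_of_repr_cx fun k => ?_
    simp only [map_add, map_sub, lp.coeFn_add, lp.coeFn_sub, Pi.add_apply, Pi.sub_apply,
      repr_multiplier, symR, repr_cx_const]
    by_cases hk : k = 0
    · subst hk
      simp [repr_cx_zero, mean_apply_coord]
    · rw [if_neg hk, sub_zero]
      have hp : (lenSq k : ℂ) ≠ 0 := by exact_mod_cast (lenSq_pos hk).ne'
      have hl : (lenSq k : ℂ) = (k 0 : ℂ) ^ 2 + (k 1 : ℂ) ^ 2 + (k 2 : ℂ) ^ 2 := by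
        simp [lenSq]
      push_cast
      rw [div_mul_eq_mul_div, div_mul_eq_mul_div, div_mul_eq_mul_div, ← add_div, ← add_div,
        div_eq_iff hp, hl]
      linear_combination -(k 0 : ℂ) * h k 0 j - (k 1 : ℂ) * h k 1 j - (k 2 : ℂ) * h k 2 j
  have := helmholtz u
  rw [hg] at this
  have h2 : u = u + curlPart u := by
    nth_rewrite 1 [this]
    abel
  exact left_eq_add.1 h2

/-! ### Potentials as bounded operators into the periodic spaces -/

lemma setIntegral_eq_of_forall_notMem {Ω : Set E3} {F : E3 → ℝ}
    (h : ∀ x, x ∉ Ω → F x = 0) : ∫ x in Ω, F x = ∫ x in univ, F x := by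
  rw [Measure.restrict_univ, setIntegral_eq_integral_of_forall_compl_eq_zero h]

lemma HasWeakGrad.restrict {U : E3 → ℝ} {G : E3 → E3} (h : HasWeakGrad univ U G) (Ω : Set E3) :
    HasWeakGrad Ω U G := by
  intro φ hφ i
  have h0 : ∀ x, x ∉ Ω → φ x = 0 := fun x hx =>
    image_eq_zero_of_notMem_tsupport fun h' => hx (hφ.2.2 h')
  have h1 : ∀ x, x ∉ Ω → pd i φ x = 0 := fun x hx =>
    image_eq_zero_of_notMem_tsupport fun h' => hx (hφ.2.2 (tsupport_pd_subset i φ h'))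
  rw [setIntegral_eq_of_forall_notMem (Ω := Ω) fun x hx => by rw [h1 x hx, mul_zero],
    setIntegral_eq_of_forall_notMem (Ω := Ω) fun x hx => by rw [h0 x hx, mul_zero],
    h φ ⟨hφ.1, hφ.2.1, subset_univ _⟩ i]

lemma HasWeakCurl.restrict {U C : E3 → E3} (h : HasWeakCurl univ U C) (Ω : Set E3) :
    HasWeakCurl Ω U C := by
  intro φ hφ
  have h0 : ∀ x, x ∉ Ω → φ x = 0 := fun x hx =>
    image_eq_zero_of_notMem_tsupport fun h' => hx (hφ.2.2 h')
  have h1 : ∀ x, x ∉ Ω → curl φ x = 0 := fun x hx =>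
    image_eq_zero_of_notMem_tsupport fun h' => hx (hφ.2.2 (tsupport_curl_subset φ h'))
  rw [setIntegral_eq_of_forall_notMem (Ω := Ω) fun x hx => by rw [h1 x hx, inner_zero_right],
    setIntegral_eq_of_forall_notMem (Ω := Ω) fun x hx => by rw [h0 x hx, inner_zero_right],
    h φ ⟨hφ.1, hφ.2.1, subset_univ _⟩]

/-- Restriction to the unit cell of the periodic extension of a function on the torus. -/
def toCell (F : Type) [NormedAddCommGroup F] [NormedSpace ℝ F] : Lp F 2 τ →L[ℝ] L2 Y F :=
  (Lp.compMeasurePreservingₗᵢ ℝ torusProj measurePreserving_torusProj).toContinuousLinearMap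

lemma coeFn_toCell {F : Type} [NormedAddCommGroup F] [NormedSpace ℝ F] (u : Lp F 2 τ) :
    toCell F u =ᵐ[volume.restrict Y] fun y => u (torusProj y) :=
  Lp.coeFn_compMeasurePreserving u measurePreserving_torusProj

/-- The scalar potential as an element of `H¹(Y)`. -/
def potentialH1 : Lp E3 2 τ →L[ℝ] H1 Y :=
  ((WithLp.prodContinuousLinearEquiv 2 ℝ (L2 Y ℝ) (L2 Y E3)).symm.toContinuousLinearMap.comp
    (((toCell ℝ).comp potential).prod ((toCell E3).comp gradPart))).codRestrict (H1 Y) fun u =>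
      ((hasWeakGrad_potential u).restrict Y).congr (coeFn_toCell _) (coeFn_toCell _)

/-- The scalar potential as an element of `H¹_#(Y)`. -/
def potentialH1Per : Lp E3 2 τ →L[ℝ] H1Per :=
  potentialH1.codRestrict H1Per fun u =>
    ⟨_, _, yPeriodic_comp_torusProj (potential u), memL2loc_torus _, memL2loc_torus (gradPart u),
      hasWeakGrad_potential u, (coeFn_toCell _).symm⟩

/-- The scalar potential as an element of `H¹_#(Y)/ℝ`. -/
def potentialModConst : Lp E3 2 τ →L[ℝ] H1PerModConst := constants.mkQL.comp potentialH1Per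

lemma gradY_potentialModConst (u : Lp E3 2 τ) :
    gradY (potentialModConst u) = toCell E3 (gradPart u) := rfl

lemma norm_mkQ_constants_le (u : H1Per) : ‖(constants.mkQ u : H1PerModConst)‖ ≤ ‖u‖ :=
  Submodule.Quotient.norm_mk_le _ _

lemma norm_potentialModConst_le (u : Lp E3 2 τ) :
    ‖potentialModConst u‖ ≤ ‖potentialH1‖ * ‖u‖ :=
  (norm_mkQ_constants_le _).trans (potentialH1.le_opNorm u)

/-- Continuity is stated for the topology coming from the metric of the quotient, the form needed
for `L²` functions with values there. -/
lemma continuous_potentialModConst :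
    @Continuous _ _ _ (PseudoMetricSpace.toUniformSpace.toTopologicalSpace)
      fun u => (potentialModConst u : H1PerModConst) :=
  potentialModConst.continuous

/-- The vector potential as an element of `H(curl, Y)`. -/
def vecPotentialHCurl : Lp E3 2 τ →L[ℝ] HCurl Y :=
  ((WithLp.prodContinuousLinearEquiv 2 ℝ (L2 Y E3) (L2 Y E3)).symm.toContinuousLinearMap.comp
    (((toCell E3).comp vecPotential).prod ((toCell E3).comp curlPart))).codRestrict (HCurl Y)
      fun u => ((hasWeakCurl_vecPotential u).restrict Y).congr (coeFn_toCell _) (coeFn_toCell _)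

/-- The vector potential as an element of `H_#(curl, Y)`. -/
def vecPotentialHCurlPer : Lp E3 2 τ →L[ℝ] HCurlPer :=
  vecPotentialHCurl.codRestrict HCurlPer fun u =>
    ⟨_, _, yPeriodic_comp_torusProj (vecPotential u), memL2loc_torus _,
      memL2loc_torus (curlPart u), hasWeakCurl_vecPotential u, (coeFn_toCell _).symm⟩

/-- The class of the vector potential in `H̃_#(curl, Y)`. -/
def vecPotentialTilde : Lp E3 2 τ →L[ℝ] HCurlTilde :=
  LinearMap.mkContinuous (HCurlTilde.mk ∘ₗ vecPotentialHCurlPer.toLinearMap)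
    ‖(toCell E3).comp curlPart‖ fun u => by
      rw [HCurlTilde.norm_eq]
      exact ((toCell E3).comp curlPart).le_opNorm u

lemma curlY_vecPotentialTilde (u : Lp E3 2 τ) :
    curlY (vecPotentialTilde u) = toCell E3 (curlPart u) := rfl

/-! ### Oscillating trigonometric fields -/

/-- The real part of `z` times an exponential monomial. -/
def trig (z : ℂ) (k : Fin 3 → ℤ) (t : TT) : ℝ := (z * UnitAddTorus.mFourier k t).re

lemma continuous_trig (z : ℂ) (k : Fin 3 → ℤ) : Continuous (trig z k) :=
  Complex.continuous_re.comp (continuous_const.mul (UnitAddTorus.mFourier k).continuous)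

/-- A real trigonometric monomial with a vector coefficient. -/
def trigVec (z : ℂ) (k : Fin 3 → ℤ) (v : E3) : C(TT, E3) :=
  ⟨fun t => trig z k t • v, (continuous_trig z k).smul continuous_const⟩

/-- Integrating against the `k`-th exponential without conjugation produces the coefficient at `-k`.
-/
lemma inner_trigVec (u : Lp E3 2 τ) (z : ℂ) (k : Fin 3 → ℤ) (v : E3) :
    inner ℝ u (ContinuousMap.toLp 2 τ ℝ (trigVec z k v)) =
      (z * ∑ m, (v m : ℂ) * fourierBasis.repr (cx (coord m u)) (-k)).re := by
  have hi : ∀ m, Integrable (fun t => UnitAddTorus.mFourier k t * (coord m u t : ℂ)) τ := fun m =>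
    (((Lp.memLp (coord m u)).integrable (by simp)).ofReal (𝕜 := ℂ)).bdd_mul (c := 1)
      (UnitAddTorus.mFourier k).continuous.aestronglyMeasurable
      (ae_of_all _ fun t => ((UnitAddTorus.mFourier k).norm_coe_le_norm t).trans
        UnitAddTorus.mFourier_norm.le)
  have e1 : z * ∑ m, (v m : ℂ) * fourierBasis.repr (cx (coord m u)) (-k) =
      ∫ t, z * ∑ m, (v m : ℂ) * (UnitAddTorus.mFourier k t * (coord m u t : ℂ)) ∂τ := by
    rw [integral_const_mul, integral_finsetSum _ fun m _ => (hi m).const_mul _]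
    simp only [repr_cx, neg_neg, integral_const_mul]
  have hI : Integrable
      (fun t => z * ∑ m, (v m : ℂ) * (UnitAddTorus.mFourier k t * (coord m u t : ℂ))) τ :=
    (integrable_finsetSum _ fun m _ => (hi m).const_mul _).const_mul _
  rw [e1, ← Complex.reCLM_apply, ← Complex.reCLM.integral_comp_comm hI, L2.inner_def]
  refine integral_congr_ae ?_
  filter_upwards [ContinuousMap.coeFn_toLp (𝕜 := ℝ) (p := 2) τ (trigVec z k v),
    ae_all_iff.2 fun m => coeFn_coord m u] with t h1 h2
  have e2 : ∑ m, (v m : ℂ) * (UnitAddTorus.mFourier k t * (coord m u t : ℂ)) =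
      UnitAddTorus.mFourier k t * ((∑ m, v m * u t m : ℝ) : ℂ) := by
    push_cast
    rw [Finset.mul_sum]
    refine Finset.sum_congr rfl fun m _ => ?_
    rw [h2]
    ring
  rw [h1, e2, Complex.reCLM_apply, ← mul_assoc, Complex.re_mul_ofReal]
  change inner ℝ (u t) (trig z k t • v) = trig z k t * _
  rw [real_inner_smul_right, PiLp.inner_apply]
  simp only [RCLike.inner_apply, conj_trivial]

/-- The phases `I` and `I² = -1` isolate the imaginary and the real part. Powers `I ^ (n + 1)` are
used because the moment identities arrive with a phase of the form `I * z`, the factor `I` coming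
from differentiation. -/
lemma sum_repr_eq_zero_of_inner_trigVec {u : Lp E3 2 τ} {k : Fin 3 → ℤ} {v : E3}
    (h : ∀ n : ℕ, inner ℝ u (ContinuousMap.toLp 2 τ ℝ (trigVec (Complex.I ^ (n + 1)) k v)) = 0) :
    ∑ m, (v m : ℂ) * fourierBasis.repr (cx (coord m u)) (-k) = 0 := by
  have h0 := h 0
  have h1 := h 1
  rw [inner_trigVec] at h0 h1
  apply Complex.ext
  · simpa [pow_succ] using h1
  · simpa using h0

lemma contDiff_mFourier_torusProj (k : Fin 3 → ℤ) :
    ContDiff ℝ ∞ fun x => UnitAddTorus.mFourier k (torusProj x) := by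
  simp only [mFourier_torusProj]
  let l : E3 →L[ℝ] ℝ := (k 0 : ℝ) • EuclideanSpace.proj 0 + (k 1 : ℝ) • EuclideanSpace.proj 1 +
    (k 2 : ℝ) • EuclideanSpace.proj 2
  have : ContDiff ℝ ∞ fun x : E3 => ((k 0 * x 0 + k 1 * x 1 + k 2 * x 2 : ℝ) : ℂ) :=
    (Complex.ofRealCLM.comp l).contDiff
  exact (contDiff_const.mul this).cexp

/-- A cut-off oscillating function. -/
def oscFun (φ : E3 → ℝ) (z : ℂ) (k : Fin 3 → ℤ) (s : ℝ) (x : E3) : ℝ :=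
  φ x * trig z k (torusProj (s • x))

lemma contDiff_trig (z : ℂ) (k : Fin 3 → ℤ) (s : ℝ) :
    ContDiff ℝ ∞ fun x : E3 => trig z k (torusProj (s • x)) :=
  Complex.reCLM.contDiff.comp (contDiff_const.mul
    ((contDiff_mFourier_torusProj k).comp (contDiff_const_smul s)))

lemma IsTest.oscFun {D : Set E3} {φ : E3 → ℝ} (hφ : IsTest D φ) (z : ℂ) (k : Fin 3 → ℤ) (s : ℝ) :
    IsTest D (oscFun φ z k s) :=
  ⟨hφ.1.mul (contDiff_trig z k s), hφ.2.1.mul_right, (tsupport_mul_subset_left).trans hφ.2.2⟩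

/-- Differentiation only rotates the phase from `z` to `I * z`, so real trigonometric fields are
closed under it up to real factors. -/
lemma pd_trig (z : ℂ) (k : Fin 3 → ℤ) (s : ℝ) (j : Fin 3) (x : E3) :
    pd j (fun x : E3 => trig z k (torusProj (s • x))) x =
      s * (2 * Real.pi * k j) * trig (Complex.I * z) k (torusProj (s • x)) := by
  obtain ⟨h1, h2⟩ := hasFDerivAt_mFourier k j (s • x)
  have h3 : HasFDerivAt (fun x : E3 => s • x) (s • ContinuousLinearMap.id ℝ E3) x :=
    (hasFDerivAt_id x).const_smul s
  have h4 := Complex.reCLM.hasFDerivAt.comp x (((h1.hasFDerivAt).comp x h3).const_mul z)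
  have h5 : pd j (fun x : E3 => trig z k (torusProj (s • x))) x = _ :=
    congrArg (fun L : E3 →L[ℝ] ℝ => L (e j)) h4.fderiv
  rw [h5]
  simp only [ContinuousLinearMap.comp_apply, smul_apply, ContinuousLinearMap.id_apply, map_smul, h2,
    Complex.reCLM_apply, trig, smul_eq_mul]
  have : z * (2 * Real.pi * Complex.I * k j * UnitAddTorus.mFourier k (torusProj (s • x))) =
      ((2 * Real.pi * k j : ℝ) : ℂ) *
        (Complex.I * z * UnitAddTorus.mFourier k (torusProj (s • x))) := by
    push_cast
    ring
  rw [mul_smul_comm, Complex.smul_re, this, Complex.re_ofReal_mul, smul_eq_mul]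
  ring

lemma pd_oscFun {D : Set E3} {φ : E3 → ℝ} (hφ : IsTest D φ) (z : ℂ) (k : Fin 3 → ℤ) (s : ℝ)
    (j : Fin 3) (x : E3) :
    pd j (oscFun φ z k s) x = pd j φ x * trig z k (torusProj (s • x)) +
      s * (2 * Real.pi * k j) * (φ x * trig (Complex.I * z) k (torusProj (s • x))) := by
  have h1 : DifferentiableAt ℝ φ x := (hφ.1.differentiable (by simp)) x
  have h2 : DifferentiableAt ℝ (fun x : E3 => trig z k (torusProj (s • x))) x :=
    ((contDiff_trig z k s).differentiable (by simp)) x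
  have h3 : pd j (oscFun φ z k s) x = _ :=
    congrArg (fun L : E3 →L[ℝ] ℝ => L (e j)) (fderiv_mul h1 h2)
  have h4 := pd_trig z k s j x
  rw [pd] at h4
  rw [h3]
  simp only [add_apply, smul_apply, h4, smul_eq_mul]
  rw [pd]
  ring

/-! ### Vector test fields built from scalar test functions -/

/-- The cross product `e j × e l`. -/
def crossBasis (j l : Fin 3) : E3 := WithLp.toLp 2 (crossProduct (e j).ofLp (e l).ofLp)

/-- This is `∇q × e_l`, expanded into partial derivatives times fixed vectors as
`integral_inner_sum_pd_oscFun` requires. -/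
lemma curl_smul_e {q : E3 → ℝ} (l : Fin 3) (x : E3) :
    curl (fun x => q x • e l) x = ∑ j, pd j q x • crossBasis j l := by
  have h0 : ∀ j, pd j (fun _ => (0 : ℝ)) x = 0 := fun j => by simp [pd]
  ext i
  rw [Fin.sum_univ_three]
  fin_cases l <;> fin_cases i <;>
    simp [curl, crossBasis, e, crossProduct, h0]

lemma IsTest.smul_const {D : Set E3} {q : E3 → ℝ} (hq : IsTest D q) (v : E3) :
    IsTest D fun x => q x • v :=
  ⟨hq.1.smul contDiff_const, hq.2.1.smul_right, (tsupport_smul_subset_left _ _).trans hq.2.2⟩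

lemma IsTest.pd {D : Set E3} {q : E3 → ℝ} (hq : IsTest D q) (j : Fin 3) : IsTest D (pd j q) :=
  ⟨(hq.1.fderiv_right (m := ∞) (by simp)).clm_apply contDiff_const,
    hq.2.1.of_isClosed_subset (isClosed_tsupport _) (tsupport_pd_subset j q),
    (tsupport_pd_subset j q).trans hq.2.2⟩

/-- The classical gradient. -/
def grad (q : E3 → ℝ) (x : E3) : E3 := WithLp.toLp 2 fun j => pd j q x

lemma IsTest.grad {D : Set E3} {q : E3 → ℝ} (hq : IsTest D q) : IsTest D (grad q) := by
  have hs : tsupport (TwoScaleCurl.grad q) ⊆ tsupport q := by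
    refine closure_minimal (fun x hx => ?_) (isClosed_tsupport q)
    by_contra h
    refine hx ?_
    ext j
    exact image_eq_zero_of_notMem_tsupport (f := TwoScaleCurl.pd j q) fun h' => h (tsupport_pd_subset j q h')
  refine ⟨?_, hq.2.1.of_isClosed_subset (isClosed_tsupport _) hs, hs.trans hq.2.2⟩
  exact contDiff_euclidean.2 fun j => (hq.pd j).1

lemma curl_grad {q : E3 → ℝ} (hq : ContDiff ℝ ∞ q) (x : E3) : curl (grad q) x = 0 := by
  have hd : DifferentiableAt ℝ (fderiv ℝ q) x :=
    ((hq.fderiv_right (m := ∞) (by simp)).differentiable (by simp)) x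
  have hsymm : ∀ i j, pd i (fun z => pd j q z) x = pd j (fun z => pd i q z) x := by
    have key : ∀ i j, pd i (fun z => pd j q z) x = fderiv ℝ (fderiv ℝ q) x (e i) (e j) := by
      intro i j
      have h := (hd.hasFDerivAt.clm_apply (hasFDerivAt_const (e j) x)).fderiv
      have h' : pd i (fun z => pd j q z) x = _ := congrArg (fun L : E3 →L[ℝ] ℝ => L (e i)) h
      rw [h']
      simp
    intro i j
    rw [key, key]
    exact (hq.contDiffAt.isSymmSndFDerivAt (by
      simpa using (WithTop.coe_le_coe.2 (le_top : (2 : ℕ∞) ≤ ⊤)))).eq _ _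
  ext i
  fin_cases i
  · simp [curl, grad, hsymm 1 2]
  · simp [curl, grad, hsymm 2 0]
  · simp [curl, grad, hsymm 0 1]

/-! ### Identification of the two-scale limits -/

lemma memLp_smul_const {D : Set E3} {φ : E3 → ℝ} (hφ : MemLp φ 2 (volume.restrict D))
    (c : C(TT, E3)) : MemLp (fun x => φ x • c) 2 (volume.restrict D) :=
  (ContinuousLinearMap.toSpanSingleton ℝ c).comp_memLp' hφ

/-- The test field `φ(x) c(y)`. -/
def tensor {D : Set E3} {φ : E3 → ℝ} (hφ : MemLp φ 2 (volume.restrict D)) (c : C(TT, E3)) :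
    L2 D C(TT, E3) := (memLp_smul_const hφ c).toLp _

lemma coeFn_tensor {D : Set E3} {φ : E3 → ℝ} (hφ : MemLp φ 2 (volume.restrict D))
    (c : C(TT, E3)) : tensor hφ c =ᵐ[volume.restrict D] fun x => φ x • c :=
  (memLp_smul_const hφ c).coeFn_toLp

lemma inner_toTwoScale_tensor {D : Set E3} {φ : E3 → ℝ} (hφ : MemLp φ 2 (volume.restrict D))
    (c : C(TT, E3)) (f : L2 D (Lp E3 2 τ)) :
    inner ℝ f (toTwoScale D (tensor hφ c)) =
      ∫ x in D, φ x * inner ℝ (f x) (ContinuousMap.toLp 2 τ ℝ c) := by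
  rw [L2.inner_def]
  refine integral_congr_ae ?_
  filter_upwards [coeFn_toTwoScale (tensor hφ c), coeFn_tensor hφ c] with x h1 h2
  rw [h1, h2, map_smul, real_inner_smul_right]

lemma inner_oscillate_tensor {D : Set E3} {φ : E3 → ℝ} (hφ : MemLp φ 2 (volume.restrict D))
    (c : C(TT, E3)) (s : ℝ) (w : L2 D E3) :
    inner ℝ w (oscillate D s (tensor hφ c)) =
      ∫ x in D, inner ℝ (w x) (φ x • c (torusProj (s • x))) := by
  rw [L2.inner_def]
  refine integral_congr_ae ?_
  filter_upwards [coeFn_oscillate s (tensor hφ c), coeFn_tensor hφ c] with x h1 h2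
  rw [h1, h2]
  rfl

lemma IsTest.memLp {D : Set E3} {F : Type} [NormedAddCommGroup F] [NormedSpace ℝ F] {φ : E3 → F}
    (hφ : IsTest D φ) : MemLp φ 2 (volume.restrict D) :=
  (hφ.1.continuous.memLp_of_hasCompactSupport hφ.2.1).restrict _

/-- Weak two-scale convergence against `L²(D; C(𝕋³)³)`. -/
def WeakTwoScale {D : Set E3} (s : ℕ → ℝ) (w : ℕ → L2 D E3) (f : L2 D (Lp E3 2 τ)) : Prop :=
  ∀ Φ : L2 D C(TT, E3),
    Tendsto (fun n => inner ℝ (w n) (oscillate D (s n) Φ)) atTop (𝓝 (inner ℝ f (toTwoScale D Φ)))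

lemma integrable_inner_smul_eval {D : Set E3} {φ : E3 → ℝ} (hφ : MemLp φ 2 (volume.restrict D))
    (c : C(TT, E3)) (s : ℝ) (w : L2 D E3) :
    Integrable (fun x => inner ℝ (w x) (φ x • c (torusProj (s • x)))) (volume.restrict D) := by
  refine (L2.integrable_inner w (oscillate D s (tensor hφ c))).congr ?_
  filter_upwards [coeFn_oscillate s (tensor hφ c), coeFn_tensor hφ c] with x h1 h2
  rw [h1, h2]
  rfl

/-- If all moments of a two-scale limit against test functions vanish, then so does the
corresponding component almost everywhere. -/
lemma ae_inner_eq_zero {D : Set E3} (hD : IsOpen D) (f : L2 D (Lp E3 2 τ)) (c : C(TT, E3))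
    (h : ∀ (φ : E3 → ℝ) (hφ : IsTest D φ),
      inner ℝ f (toTwoScale D (tensor hφ.memLp c)) = 0) :
    ∀ᵐ x ∂(volume.restrict D), inner ℝ (f x) (ContinuousMap.toLp 2 τ ℝ c : Lp E3 2 τ) = 0 := by
  have hl : LocallyIntegrableOn
      (fun x => inner ℝ (f x) (ContinuousMap.toLp 2 τ ℝ c : Lp E3 2 τ)) D := by
    refine (locallyIntegrableOn_iff hD.isLocallyClosed).2 fun K hKD hK => ?_
    have : IsFiniteMeasure (volume.restrict K) := ⟨by simpa using hK.measure_lt_top⟩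
    have h1 := ((memL2loc_Lp f) K hK hKD).integrable (by norm_num)
    exact ((innerSL ℝ).flip (ContinuousMap.toLp 2 τ ℝ c : Lp E3 2 τ)).integrable_comp h1
  rw [ae_restrict_iff' hD.measurableSet]
  refine hD.ae_eq_zero_of_integral_contDiff_smul_eq_zero hl fun φ hφ hc hs => ?_
  have h1 := h φ ⟨hφ, hc, hs⟩
  rw [inner_toTwoScale_tensor] at h1
  rw [← h1, eq_comm]
  refine setIntegral_eq_integral_of_forall_compl_eq_zero fun x hx => ?_
  rw [image_eq_zero_of_notMem_tsupport fun h => hx (hs h), zero_mul]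

section Limits

variable {D : Set E3} {s : ℕ → ℝ} {w : ℕ → HCurl D} {f g : L2 D (Lp E3 2 τ)}

/-- If `aₙ + sₙ bₙ = cₙ` with `aₙ`, `cₙ` convergent and `sₙ → ∞`, then `bₙ → 0`. -/
lemma eq_zero_of_scaled {s a b : ℕ → ℝ} (hs : Tendsto s atTop atTop) {A B : ℝ}
    (ha : Tendsto a atTop (𝓝 A)) (hb : Tendsto b atTop (𝓝 B)) (h : ∀ n, s n * b n = a n) :
    B = 0 := by
  have h1 : Tendsto (fun n => (s n)⁻¹ * a n) atTop (𝓝 (0 * A)) := (hs.inv_tendsto_atTop).mul ha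
  rw [zero_mul] at h1
  refine tendsto_nhds_unique hb (h1.congr' ?_)
  filter_upwards [hs.eventually_gt_atTop 0] with n hn
  rw [← h n, inv_mul_cancel_left₀ hn.ne']

lemma trigVec_sum (z : ℂ) (k : Fin 3 → ℤ) (v : Fin 3 → E3) (t : TT) :
    trigVec z k (∑ j, (k j : ℝ) • v j) t = ∑ j, (k j * trig z k t) • v j := by
  simp only [trigVec, ContinuousMap.coe_mk, Finset.smul_sum, smul_smul]
  exact Finset.sum_congr rfl fun j _ => by rw [mul_comm]

/-- The integral of a field against a combination of derivatives of an oscillating test function. -/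
lemma integral_inner_sum_pd_oscFun {φ : E3 → ℝ} (hφ : IsTest D φ) (z : ℂ) (k : Fin 3 → ℤ)
    (v : Fin 3 → E3) (s : ℝ) (u : L2 D E3) :
    ∫ x in D, inner ℝ (u x) (∑ j, pd j (oscFun φ z k s) x • v j) =
      (∑ j, inner ℝ u (oscillate D s (tensor (hφ.pd j).memLp (trigVec z k (v j))))) +
      s * (2 * Real.pi * inner ℝ u (oscillate D s (tensor hφ.memLp
        (trigVec (Complex.I * z) k (∑ j, (k j : ℝ) • v j))))) := by
  simp only [inner_oscillate_tensor]
  rw [← integral_const_mul, ← integral_const_mul,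
    ← integral_finsetSum _ fun j _ => integrable_inner_smul_eval (hφ.pd j).memLp _ s u,
    ← integral_add (integrable_finsetSum _ fun j _ =>
      integrable_inner_smul_eval (hφ.pd j).memLp _ s u)
      (((integrable_inner_smul_eval hφ.memLp _ s u).const_mul _).const_mul _)]
  refine integral_congr_ae (ae_of_all _ fun x => ?_)
  simp only [pd_oscFun hφ, trigVec_sum]
  simp only [trigVec, ContinuousMap.coe_mk, inner_sum, Finset.smul_sum, smul_smul, add_smul,
    inner_add_right, real_inner_smul_right, Finset.sum_add_distrib, Finset.mul_sum]
  congr 1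
  exact Finset.sum_congr rfl fun j _ => by ring

/-- The two-scale limit of a sequence bounded in `H(curl)` is curl-free in the fast variable. -/
lemma moment_crossBasis_eq_zero (hs : Tendsto s atTop atTop)
    (hf : WeakTwoScale s (fun n => HCurl.toL2 (w n)) f)
    (hg : WeakTwoScale s (fun n => HCurl.curl (w n)) g) (z : ℂ) (k : Fin 3 → ℤ) (l : Fin 3)
    {φ : E3 → ℝ} (hφ : IsTest D φ) :
    inner ℝ f (toTwoScale D (tensor hφ.memLp
      (trigVec (Complex.I * z) k (∑ j, (k j : ℝ) • crossBasis j l)))) = 0 := by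
  -- `h1` collects the terms of order one: the curl term and those where the derivative falls on
  -- `φ`. `h2` holds the terms where it falls on the oscillation, which carry the factor `s n`; the
  -- weak curl identity balances the two, so the limit in `h2` is zero.
  have h1 := (hg (tensor hφ.memLp (trigVec z k (e l)))).sub
    (tendsto_finsetSum Finset.univ fun j _ =>
      hf (tensor (hφ.pd j).memLp (trigVec z k (crossBasis j l))))
  have h2 := (hf (tensor hφ.memLp
    (trigVec (Complex.I * z) k (∑ j, (k j : ℝ) • crossBasis j l)))).const_mul (2 * Real.pi)
  have h3 := eq_zero_of_scaled hs h1 h2 fun n => by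
    have hw : HasWeakCurl D (HCurl.toL2 (w n)) (HCurl.curl (w n)) := (w n).2
    have h := hw _ ((hφ.oscFun z k (s n)).smul_const (e l))
    simp only [curl_smul_e] at h
    rw [integral_inner_sum_pd_oscFun hφ] at h
    rw [eq_sub_iff_add_eq', h, inner_oscillate_tensor]
    refine integral_congr_ae (ae_of_all _ fun x => ?_)
    simp only [trigVec, ContinuousMap.coe_mk, smul_smul, oscFun]
  have hpi := Real.pi_pos
  exact (mul_eq_zero.1 h3).resolve_left (by positivity)

/-- The two-scale limit of the curls is divergence-free in the fast variable. -/
lemma moment_grad_eq_zero (hs : Tendsto s atTop atTop)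
    (hg : WeakTwoScale s (fun n => HCurl.curl (w n)) g) (z : ℂ) (k : Fin 3 → ℤ)
    {φ : E3 → ℝ} (hφ : IsTest D φ) :
    inner ℝ g (toTwoScale D (tensor hφ.memLp
      (trigVec (Complex.I * z) k (∑ j, (k j : ℝ) • e j)))) = 0 := by
  have h1 := (tendsto_finsetSum Finset.univ fun j _ =>
      hg (tensor (hφ.pd j).memLp (trigVec z k (e j)))).neg
  have h2 := (hg (tensor hφ.memLp
    (trigVec (Complex.I * z) k (∑ j, (k j : ℝ) • e j)))).const_mul (2 * Real.pi)
  have h3 := eq_zero_of_scaled hs h1 h2 fun n => by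
    have hw : HasWeakCurl D (HCurl.toL2 (w n)) (HCurl.curl (w n)) := (w n).2
    have hq := hφ.oscFun z k (s n)
    -- A gradient test field has no curl, so `HCurl.toL2 (w n)` drops out and only the curls remain.
    have h := hw _ hq.grad
    have hgr : ∀ x, grad (oscFun φ z k (s n)) x = ∑ j, pd j (oscFun φ z k (s n)) x • e j := by
      intro x
      ext i
      fin_cases i <;> simp [grad, e, Fin.sum_univ_three]
    simp only [curl_grad hq.1, inner_zero_right, integral_zero, hgr] at h
    rw [integral_inner_sum_pd_oscFun hφ] at h
    rw [eq_neg_iff_add_eq_zero, add_comm, ← h]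
  have hpi := Real.pi_pos
  exact (mul_eq_zero.1 h3).resolve_left (by positivity)

lemma ae_curlPart_eq_zero (hD : IsOpen D) (hs : Tendsto s atTop atTop)
    (hf : WeakTwoScale s (fun n => HCurl.toL2 (w n)) f)
    (hg : WeakTwoScale s (fun n => HCurl.curl (w n)) g) :
    ∀ᵐ x ∂(volume.restrict D), curlPart (f x) = 0 := by
  have h1 : ∀ᵐ x ∂(volume.restrict D), ∀ (k : Fin 3 → ℤ) (l : Fin 3) (n : ℕ),
      inner ℝ (f x) (ContinuousMap.toLp 2 τ ℝ
        (trigVec (Complex.I ^ (n + 1)) k (∑ j, (k j : ℝ) • crossBasis j l)) : Lp E3 2 τ) = 0 := by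
    -- The family of moments is countable, so a single null set of `x` serves all of them.
    refine ae_all_iff.2 fun k => ae_all_iff.2 fun l => ae_all_iff.2 fun n => ?_
    refine ae_inner_eq_zero hD f _ fun φ hφ => ?_
    rw [pow_succ']
    exact moment_crossBasis_eq_zero hs hf hg _ k l hφ
  filter_upwards [h1] with x hx
  have h2 := fun k l => sum_repr_eq_zero_of_inner_trigVec (hx k l)
  refine curlPart_eq_zero fun k => ?_
  -- The moment at `-k` yields the Fourier coefficient at `k`.
  have h3 := fun l => h2 (-k) l
  simp only [neg_neg, Fin.sum_univ_three] at h3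
  have e0 := h3 0
  have e1 := h3 1
  have e2 := h3 2
  simp [crossBasis, crossProduct, e] at e0 e1 e2
  intro i j
  -- The diagonal cases are trivial; the other six are the components of `k × û = 0` up to sign.
  fin_cases i <;> fin_cases j <;> simp only [Fin.zero_eta, Fin.mk_one, Fin.reduceFinMk]
  · linear_combination e2
  · linear_combination -e1
  · linear_combination -e2
  · linear_combination e0
  · linear_combination e1
  · linear_combination -e0

lemma ae_gradPart_eq_zero (hD : IsOpen D) (hs : Tendsto s atTop atTop)
    (hg : WeakTwoScale s (fun n => HCurl.curl (w n)) g) :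
    ∀ᵐ x ∂(volume.restrict D), gradPart (g x) = 0 := by
  have h1 : ∀ᵐ x ∂(volume.restrict D), ∀ (k : Fin 3 → ℤ) (n : ℕ),
      inner ℝ (g x) (ContinuousMap.toLp 2 τ ℝ
        (trigVec (Complex.I ^ (n + 1)) k (∑ j, (k j : ℝ) • e j)) : Lp E3 2 τ) = 0 := by
    refine ae_all_iff.2 fun k => ae_all_iff.2 fun n => ?_
    refine ae_inner_eq_zero hD g _ fun φ hφ => ?_
    rw [pow_succ']
    exact moment_grad_eq_zero hs hg _ k hφ
  filter_upwards [h1] with x hx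
  refine gradPart_eq_zero fun k => ?_
  have h2 := sum_repr_eq_zero_of_inner_trigVec (hx (-k))
  simp only [neg_neg, Fin.sum_univ_three] at h2 ⊢
  simp [e] at h2
  linear_combination -h2

lemma memLp_constTest {φ : E3 → E3} (hφ : MemLp φ 2 (volume.restrict D)) :
    MemLp (fun x => ContinuousMap.const TT (φ x)) 2 (volume.restrict D) :=
  (hφ.norm.of_le ((ContinuousMap.continuous_const'.comp_aestronglyMeasurable hφ.1)) (ae_of_all _ fun x => by
    refine (ContinuousMap.norm_le _ (by positivity)).2 fun t => ?_
    simp))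

lemma inner_toLp_const (u : Lp E3 2 τ) (v : E3) :
    inner ℝ u (ContinuousMap.toLp 2 τ ℝ (ContinuousMap.const TT v) : Lp E3 2 τ) =
      inner ℝ (mean u) v := by
  rw [L2.inner_def, mean_apply, real_inner_comm,
    ← integral_inner ((Lp.memLp u).integrable (by simp))]
  refine integral_congr_ae ?_
  filter_upwards [ContinuousMap.coeFn_toLp (𝕜 := ℝ) (p := 2) τ (ContinuousMap.const TT v)] with t ht
  rw [ht, real_inner_comm]
  rfl

/-- Test fields constant in `y` pair only with the mean, so two-scale convergence implies weak `L²`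
convergence to the mean. -/
lemma tendsto_inner_of_weakTwoScale {u : ℕ → L2 D E3} (hf : WeakTwoScale s u f) {φ : E3 → E3}
    (hφ : MemLp φ 2 (volume.restrict D)) :
    Tendsto (fun n => ∫ x in D, inner ℝ (u n x) (φ x)) atTop
      (𝓝 (∫ x in D, inner ℝ (mean.compLpL 2 _ f x) (φ x))) := by
  have h := hf ((memLp_constTest hφ).toLp _)
  have e1 : ∀ n, inner ℝ (u n) (oscillate D (s n) ((memLp_constTest hφ).toLp _)) =
      ∫ x in D, inner ℝ (u n x) (φ x) := by
    intro n
    rw [L2.inner_def]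
    refine integral_congr_ae ?_
    filter_upwards [coeFn_oscillate (s n) ((memLp_constTest hφ).toLp _),
      (memLp_constTest hφ).coeFn_toLp] with x h1 h2
    rw [h1, h2]
    rfl
  have e2 : inner ℝ f (toTwoScale D ((memLp_constTest hφ).toLp _)) =
      ∫ x in D, inner ℝ (mean.compLpL 2 _ f x) (φ x) := by
    rw [L2.inner_def]
    refine integral_congr_ae ?_
    filter_upwards [coeFn_toTwoScale ((memLp_constTest hφ).toLp _),
      (memLp_constTest hφ).coeFn_toLp, mean.coeFn_compLpL (p := 2) f] with x h1 h2 h3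
    rw [h1, h2, h3, inner_toLp_const]
  simpa only [e1, e2] using h

/-- The local averages of the limits form an element of `H(curl, D)`. -/
lemma hasWeakCurl_mean (hf : WeakTwoScale s (fun n => HCurl.toL2 (w n)) f)
    (hg : WeakTwoScale s (fun n => HCurl.curl (w n)) g) :
    HasWeakCurl D (mean.compLpL 2 (volume.restrict D) f)
      (mean.compLpL 2 (volume.restrict D) g) := by
  intro φ hφ
  have hc : MemLp (curl φ) 2 (volume.restrict D) :=
    ((continuous_curl hφ.1).memLp_of_hasCompactSupport
      (hφ.2.1.of_isClosed_subset (isClosed_tsupport _) (tsupport_curl_subset φ))).restrict _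
  have h1 := tendsto_inner_of_weakTwoScale hf hc
  have h2 := tendsto_inner_of_weakTwoScale hg hφ.memLp
  have hw : ∀ n, HasWeakCurl D (HCurl.toL2 (w n)) (HCurl.curl (w n)) := fun n => (w n).2
  simp only [fun n => hw n φ hφ] at h1
  exact tendsto_nhds_unique h1 h2

end Limits

/-! ### Admissible test functions -/

/-- Joint continuity descends along the quotient map `id × torusProj`. Currying then gives a map on
`D` continuous for the sup norm, hence strongly measurable since `D` is open. -/
lemma IsTwoScaleTest.exists_continuousMap {D : Set E3} (hD : IsOpen D) {φ : E3 → E3 → ℝ}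
    (h : IsTwoScaleTest D φ) : ∃ Φ : E3 → C(TT, ℝ), AEStronglyMeasurable Φ (volume.restrict D) ∧
      ∀ x ∈ D, ∀ y, Φ x (torusProj y) = φ x y := by
  classical
  -- The section `σ` need not be continuous; by periodicity the composite does not depend on its
  -- choice.
  obtain ⟨σ, hσ⟩ := isOpenQuotientMap_torusProj.surjective.hasRightInverse
  have hval : ∀ x ∈ D, ∀ y, φ x (σ (torusProj y)) = φ x y := fun x hx y =>
    (h.periodic x hx).eq_of_torusProj_eq (hσ _)
  have hq : IsOpenQuotientMap (Prod.map (id : D → D) torusProj) :=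
    IsOpenQuotientMap.id.prodMap isOpenQuotientMap_torusProj
  have hcont : Continuous fun p : D × TT => φ p.1 (σ p.2) := by
    rw [← hq.continuous_comp_iff]
    have h1 : Continuous fun p : D × E3 => φ p.1 p.2 :=
      h.smooth.continuousOn.comp_continuous (by fun_prop : Continuous fun p : D × E3 => ((p.1 : E3), p.2))
        fun p => ⟨p.1.2, mem_univ _⟩
    refine h1.congr fun p => ?_
    exact (hval p.1 p.1.2 p.2).symm
  let Ψ : C(D, C(TT, ℝ)) := ContinuousMap.curry ⟨_, hcont⟩
  refine ⟨fun x => if hx : x ∈ D then Ψ ⟨x, hx⟩ else 0, ?_, fun x hx y => ?_⟩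
  · refine ContinuousOn.aestronglyMeasurable ?_ hD.measurableSet
    rw [continuousOn_iff_continuous_domRestrict]
    refine Ψ.continuous.congr fun x => ?_
    simp
  · simp only [dif_pos hx]
    exact hval x hx y

lemma integral_torus_eq {q : TT → ℝ} (hq : AEStronglyMeasurable q τ) :
    ∫ t, q t ∂τ = ∫ y in Y, q (torusProj y) := by
  rw [← measurePreserving_torusProj.map_eq] at hq ⊢
  exact integral_map continuous_torusProj.aemeasurable hq

/-- An admissible `φ` becomes the test field `φ(x, ·) eᵢ`. The domination condition says precisely
that its sup norm in `y` is bounded by an `L²(D)` function, which places it in `L²(D; C(𝕋³)³)`. -/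
lemma twoScaleTendstoVec_of_weakTwoScale {D : Set E3} (hD : IsOpen D) {ε : ℕ → ℝ}
    {w : ℕ → L2 D E3} {f : L2 D (Lp E3 2 τ)} (hf : WeakTwoScale (fun n => (ε n)⁻¹) w f)
    {ξ : Lp E3 2 (volDY D)}
    (hξ : ∀ᵐ x ∂(volume.restrict D), ∀ᵐ y ∂(volume.restrict Y), ξ (x, y) = f x (torusProj y)) :
    TwoScaleTendstoVec D ε (fun n => w n) ξ := by
  intro i
  have hcoord : ∀ {α : Type} [MeasurableSpace α] {κ : Measure α} (u : Lp E3 2 κ),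
      MemLp (fun x => u x i) 2 κ := fun u =>
    (EuclideanSpace.proj (𝕜 := ℝ) i : E3 →L[ℝ] ℝ).comp_memLp' (Lp.memLp u)
  refine ⟨fun n => hcoord (w n), hcoord ξ, fun φ hφ => ?_⟩
  obtain ⟨Φ, hΦm, hΦ⟩ := hφ.exists_continuousMap hD
  obtain ⟨b, hb, hφb⟩ := hφ.dominated
  let T : C(TT, ℝ) →L[ℝ] C(TT, E3) :=
    ContinuousLinearMap.compLeftContinuous ℝ TT (ContinuousLinearMap.toSpanSingleton ℝ (e i))
  have hT : ∀ c t, T c t = c t • e i := fun c t => rfl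
  have hmem : MemLp Φ 2 (volume.restrict D) := by
    refine hb.of_le hΦm ?_
    filter_upwards [ae_restrict_mem hD.measurableSet] with x hx
    refine (ContinuousMap.norm_le _ (norm_nonneg _)).2 fun t => ?_
    obtain ⟨y, rfl⟩ := isOpenQuotientMap_torusProj.surjective t
    rw [hΦ x hx]
    exact (hφb x hx y).trans (le_abs_self _)
  have hTm := T.comp_memLp' hmem
  have h := hf (hTm.toLp _)
  have hinner : ∀ (v : E3) (a : ℝ), inner ℝ v (a • e i) = v i * a := by
    intro v a
    rw [real_inner_smul_right, e, EuclideanSpace.inner_single_right]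
    simp [mul_comm]
  have e1 : ∀ n, inner ℝ (w n) (oscillate D (ε n)⁻¹ (hTm.toLp _)) =
      ∫ x in D, w n x i * φ x ((ε n)⁻¹ • x) := by
    intro n
    rw [L2.inner_def]
    refine integral_congr_ae ?_
    filter_upwards [coeFn_oscillate (ε n)⁻¹ (hTm.toLp _), hTm.coeFn_toLp,
      ae_restrict_mem hD.measurableSet] with x h1 h2 hx
    rw [h1, h2]
    change inner ℝ (w n x) (T (Φ x) _) = _
    rw [hT, hinner, hΦ x hx]
  have e2 : inner ℝ f (toTwoScale D (hTm.toLp _)) =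
      ∫ x in D, ∫ y in Y, ξ (x, y) i * φ x y := by
    rw [L2.inner_def]
    refine integral_congr_ae ?_
    filter_upwards [coeFn_toTwoScale (hTm.toLp _), hTm.coeFn_toLp,
      ae_restrict_mem hD.measurableSet, hξ] with x h1 h2 hx hξx
    rw [h1, h2, L2.inner_def]
    have e3 : ∫ t, inner ℝ (f x t) ((ContinuousMap.toLp 2 τ ℝ (T (Φ x)) : Lp E3 2 τ) t) ∂τ =
        ∫ t, f x t i * Φ x t ∂τ := by
      refine integral_congr_ae ?_
      filter_upwards [ContinuousMap.coeFn_toLp (𝕜 := ℝ) (p := 2) τ (T (Φ x))] with t ht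
      rw [ht, hT, hinner]
    have hm : AEStronglyMeasurable (fun t => f x t i * Φ x t) τ :=
      (hcoord (f x)).1.mul (Φ x).continuous.aestronglyMeasurable
    refine e3.trans ?_
    rw [integral_torus_eq hm]
    refine integral_congr_ae ?_
    filter_upwards [hξx] with y hy
    rw [hy, hΦ x hx]
  simpa only [e1, e2] using h

/-! ### Assembly of the limits and their decompositions -/

lemma WeakTwoScale.comp {D : Set E3} {s : ℕ → ℝ} {w : ℕ → L2 D E3} {f : L2 D (Lp E3 2 τ)}
    (h : WeakTwoScale s w f) {k : ℕ → ℕ} (hk : StrictMono k) :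
    WeakTwoScale (s ∘ k) (w ∘ k) f := fun Φ => (h Φ).comp hk.tendsto_atTop

lemma exists_ae_eq_torusProj {D : Set E3} (f : L2 D (Lp E3 2 τ)) : ∃ ξ : Lp E3 2 (volDY D),
    ∀ᵐ x ∂(volume.restrict D), ∀ᵐ y ∂(volume.restrict Y), ξ (x, y) = f x (torusProj y) := by
  obtain ⟨ξ, hξ⟩ := exists_isUncurry ((toCell E3).compLpL 2 (volume.restrict D) f)
  refine ⟨ξ, ?_⟩
  filter_upwards [hξ, (toCell E3).coeFn_compLpL (p := 2) f] with x h1 h2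
  filter_upwards [h1, coeFn_toCell (f x)] with y h3 h4
  rw [h3, h2, h4]

lemma ae_const_add {u v c : Lp E3 2 τ} {a : E3} (hu : u = c + v) (hc : c = Lp.const 2 τ a) :
    ∀ᵐ y ∂(volume.restrict Y), u (torusProj y) = a + toCell E3 v y := by
  have h1 : ∀ᵐ t ∂τ, u t = a + v t := by
    rw [hu, hc]
    filter_upwards [Lp.coeFn_add (Lp.const 2 τ a) v, Lp.coeFn_const 2 τ a] with t h2 h3
    rw [h2, Pi.add_apply, h3]
    rfl
  filter_upwards [measurePreserving_torusProj.quasiMeasurePreserving.ae h1, coeFn_toCell v]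
    with y h2 h3
  rw [h2, h3]

lemma exists_Lp_ae_eq_comp {G H : Type} [NormedAddCommGroup G] [NormedAddCommGroup H] {P : H → G}
    (hP : Continuous P) {c : ℝ} (hc : ∀ u, ‖P u‖ ≤ c * ‖u‖) {D : Set E3} (f : L2 D H) :
    ∃ F : L2 D G, ∀ᵐ x ∂(volume.restrict D), F x = P (f x) := by
  have h : MemLp (fun x => P (f x)) 2 (volume.restrict D) := (Lp.memLp f).of_le_mul
    (hP.comp_aestronglyMeasurable (Lp.aestronglyMeasurable f)) (ae_of_all _ fun _ => hc _)
  exact ⟨h.toLp _, h.coeFn_toLp⟩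

lemma exists_potentialModConst_comp {D : Set E3} (f : L2 D (Lp E3 2 τ)) :
    ∃ F : Lp H1PerModConst 2 (volume.restrict D),
      ∀ᵐ x ∂(volume.restrict D), F x = potentialModConst (f x) :=
  exists_Lp_ae_eq_comp continuous_potentialModConst norm_potentialModConst_le f

lemma ae_eq_mean_add_gradY {D : Set E3} {f : L2 D (Lp E3 2 τ)} {ξ : Lp E3 2 (volDY D)}
    (hξ : ∀ᵐ x ∂(volume.restrict D), ∀ᵐ y ∂(volume.restrict Y), ξ (x, y) = f x (torusProj y))
    (hf : ∀ᵐ x ∂(volume.restrict D), curlPart (f x) = 0)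
    {F : Lp H1PerModConst 2 (volume.restrict D)}
    (hF : ∀ᵐ x ∂(volume.restrict D), F x = potentialModConst (f x)) :
    ∀ᵐ x ∂(volume.restrict D), ∀ᵐ y ∂(volume.restrict Y),
      ξ (x, y) = mean.compLpL 2 (volume.restrict D) f x + gradY (F x) y := by
  filter_upwards [hξ, hf, mean.coeFn_compLpL (p := 2) f, hF] with x h1 h2 h3 h4
  have h5 := helmholtz (f x)
  rw [h2, add_zero] at h5
  filter_upwards [h1, ae_const_add h5 rfl] with y h6 h7
  rw [h6, h7, h4, h3, gradY_potentialModConst]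

lemma ae_eq_mean_add_curlY {D : Set E3} {g : L2 D (Lp E3 2 τ)} {η : Lp E3 2 (volDY D)}
    (hη : ∀ᵐ x ∂(volume.restrict D), ∀ᵐ y ∂(volume.restrict Y), η (x, y) = g x (torusProj y))
    (hg : ∀ᵐ x ∂(volume.restrict D), gradPart (g x) = 0) :
    ∀ᵐ x ∂(volume.restrict D), ∀ᵐ y ∂(volume.restrict Y),
      η (x, y) = mean.compLpL 2 (volume.restrict D) g x +
        curlY (vecPotentialTilde.compLpL 2 (volume.restrict D) g x) y := by
  filter_upwards [hη, hg, mean.coeFn_compLpL (p := 2) g,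
    vecPotentialTilde.coeFn_compLpL (p := 2) g] with x h1 h2 h3 h4
  have h5 := helmholtz (g x)
  rw [h2, add_zero] at h5
  filter_upwards [h1, ae_const_add h5 rfl] with y h6 h7
  rw [h6, h7, h4, h3, curlY_vecPotentialTilde]

lemma HCurl.norm_toL2_le {D : Set E3} (w : HCurl D) : ‖HCurl.toL2 w‖ ≤ ‖w‖ :=
  WithLp.norm_fst_le _ (w : WithLp 2 (L2 D E3 × L2 D E3))

lemma HCurl.norm_curl_le {D : Set E3} (w : HCurl D) : ‖HCurl.curl w‖ ≤ ‖w‖ :=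
  WithLp.norm_snd_le _ (w : WithLp 2 (L2 D E3 × L2 D E3))

lemma HCurl.exists_of_hasWeakCurl {D : Set E3} {u c : L2 D E3} (h : HasWeakCurl D u c) :
    ∃ w : HCurl D, HCurl.toL2 w = u ∧ HCurl.curl w = c :=
  ⟨⟨WithLp.toLp 2 (u, c), h⟩, rfl, rfl⟩

/-- The second extraction is made inside the first, and the first limit persists, so one subsequence
serves the fields and their curls. -/
lemma exists_subseq_weakTwoScale_pair {D : Set E3} {s : ℕ → ℝ} (hs : Tendsto s atTop atTop)
    {u v : ℕ → L2 D E3} {C : ℝ} (hu : ∀ n, ‖u n‖ ≤ C) (hv : ∀ n, ‖v n‖ ≤ C) :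
    ∃ k : ℕ → ℕ, StrictMono k ∧ ∃ f g : L2 D (Lp E3 2 τ),
      WeakTwoScale (s ∘ k) (u ∘ k) f ∧ WeakTwoScale (s ∘ k) (v ∘ k) g := by
  obtain ⟨k₁, hk₁, f, hf⟩ := exists_subseq_twoScale hs u hu
  obtain ⟨k₂, hk₂, g, hg⟩ := exists_subseq_twoScale (hs.comp hk₁.tendsto_atTop) (v ∘ k₁)
    fun n => hv (k₁ n)
  exact ⟨k₁ ∘ k₂, hk₁.comp hk₂, f, g,
    WeakTwoScale.comp (s := s ∘ k₁) (w := u ∘ k₁) hf hk₂, hg⟩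

set_option maxHeartbeats 1000000 in
lemma exists_twoScale_decomposition {D : Set E3} (hD : IsOpen D) {ε : ℕ → ℝ}
    (hs : Tendsto (fun n => (ε n)⁻¹) atTop atTop) {w : ℕ → HCurl D} {f g : L2 D (Lp E3 2 τ)}
    (hf : WeakTwoScale (fun n => (ε n)⁻¹) (fun n => HCurl.toL2 (w n)) f)
    (hg : WeakTwoScale (fun n => (ε n)⁻¹) (fun n => HCurl.curl (w n)) g) :
    ∃ (w₀ : HCurl D) (𝔴₁ : Lp H1PerModConst 2 (volume.restrict D))
      (w₁ : Lp HCurlTilde 2 (volume.restrict D)) (ξ η : Lp E3 2 (volDY D)),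
      (∀ᵐ x ∂(volume.restrict D), ∀ᵐ y ∂(volume.restrict Y),
        ξ (x, y) = HCurl.toL2 w₀ x + gradY (𝔴₁ x) y) ∧
      (∀ᵐ x ∂(volume.restrict D), ∀ᵐ y ∂(volume.restrict Y),
        η (x, y) = HCurl.curl w₀ x + curlY (w₁ x) y) ∧
      TwoScaleTendstoVec D ε (fun n => HCurl.toL2 (w n)) ξ ∧
      TwoScaleTendstoVec D ε (fun n => HCurl.curl (w n)) η := by
  obtain ⟨ξ, hξ⟩ := exists_ae_eq_torusProj f
  obtain ⟨η, hη⟩ := exists_ae_eq_torusProj g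
  -- A single `w₀` accounts for both limits because the mean of `g` is the weak curl of the mean of
  -- `f`.
  obtain ⟨w₀, hu, hc⟩ := HCurl.exists_of_hasWeakCurl (hasWeakCurl_mean hf hg)
  obtain ⟨F, hF⟩ := exists_potentialModConst_comp f
  refine ⟨w₀, F, vecPotentialTilde.compLpL 2 (volume.restrict D) g, ξ, η, ?_, ?_,
    twoScaleTendstoVec_of_weakTwoScale hD hf hξ, twoScaleTendstoVec_of_weakTwoScale hD hg hη⟩
  · rw [hu]
    exact ae_eq_mean_add_gradY hξ (ae_curlPart_eq_zero hD hs hf hg) hF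
  · rw [hc]
    exact ae_eq_mean_add_curlY hη (ae_gradPart_eq_zero hD hs hg)

end TwoScaleCurl

end

theorem mainTheorem4 (D : Set E3) (hD : IsOpen D)
    (ε : ℕ → ℝ) (hε : ∀ n, 0 < ε n) (hε0 : Tendsto ε atTop (𝓝 0))
    (w : ℕ → HCurl D) (hw : ∃ C : ℝ, ∀ n, ‖w n‖ ≤ C) :
    ∃ k : ℕ → ℕ, StrictMono k ∧
      ∃ (w₀ : HCurl D) (𝔴₁ : Lp H1PerModConst 2 (volume.restrict D))
        (w₁ : Lp HCurlTilde 2 (volume.restrict D)) (ξ η : Lp E3 2 (volDY D)),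
        (∀ᵐ x ∂(volume.restrict D), ∀ᵐ y ∂(volume.restrict Y),
          ξ (x, y) = HCurl.toL2 w₀ x + gradY (𝔴₁ x) y) ∧
        (∀ᵐ x ∂(volume.restrict D), ∀ᵐ y ∂(volume.restrict Y),
          η (x, y) = HCurl.curl w₀ x + curlY (w₁ x) y) ∧
        TwoScaleTendstoVec D (ε ∘ k) (fun n => HCurl.toL2 (w (k n))) ξ ∧
        TwoScaleTendstoVec D (ε ∘ k) (fun n => HCurl.curl (w (k n))) η := by
  obtain ⟨C, hC⟩ := hw
  have hs := tendsto_inv_scale hε hε0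
  obtain ⟨k, hk, f, g, hf, hg⟩ := exists_subseq_weakTwoScale_pair hs
    (fun n => (HCurl.norm_toL2_le (w n)).trans (hC n))
    (fun n => (HCurl.norm_curl_le (w n)).trans (hC n))
  exact ⟨k, hk, exists_twoScale_decomposition (w := w ∘ k) hD (hs.comp hk.tendsto_atTop) hf hg⟩
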